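/- **Conventions.** Fix an infinite set $V$ of symbols. A language is a set of words over $V$; it is *uniform-length* if all its words have the same length. The following models represent languages. * **CFG**: context-free grammars (finitely many productions). The size is the number of occurrences of symbols and operators in the right-hand sides, where the productions of a nonterminal are written as one rule $A\to\alpha_1\cup\dots\cup\alpha_m$ ($\varepsilon$ counts as one symbol, and $k\ge1$ concatenated symbols count $2k-1$). **UCFG**: CFGs in which every word of the language has exactly one derivation tree. * **NFA**: nondeterministic finite automata without $\varepsilon$-transitions, with a set of initial states, a set of accepting states, and finitely many transitions; the size is the number of states plus the number of transitions. **UFA**: NFAs in which every word has at most one accepting run. **DFA**: NFAs with exactly one initial state and at most one successor for every state and symbol. * **Set**: finite sets $S$ of words, listed explicitly; the size is $\sum_{w\in S}(|w|+1)$. For $f:\mathbb N\to\mathbb R$ there is an *$f(n)$-size translation* from a model $X$ to a model $Y$ over uniform-length languages if every object of $X$ of size $n$ with a uniform-length language has an equivalent object (same language) in $Y$ of size $O(f(n))$. It is *tight* if there is an infinite family of objects of $X$ with uniform-length languages, of strictly increasing sizes, such that for each member, of size $n$, every equivalent object in $Y$ has size $\Omega(f(n))$. For a class $F$ of functions, there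 is a (tight) $F$-translation if there is a (tight) $f(n)$-size translation for some $f\in F$. *Exponential* functions are those of the form $2^{\Theta(n)}$, *double-exponential* functions those of the form $2^{2^{\Theta(n)}}$; *root-exponential* functions are those with $2^{c\sqrt n}\le f(n)\le 2^{Cn}$ for some constants $c>0$, $C$ and all large $n$. **Theorem.** Over uniform-length languages, there are exponential translations * (E1) from CFG to NFA; * (E2) from UCFG to UFA; * (E3) from NFA to UCFG; * (E4) from NFA to UFA; * (E5) from UFA to DFA; * (E6) from DFA to Set; * (E7) from NFA to Set; and double-exponential translations * (DE1) from CFG to UFA; * (DE2) from CFG to UCFG; * (DE3) from UCFG to DFA; * (DE4) from CFG to Set. Furthermore, for (E1), (E2), (E6), (E7) there are tight exponential translations, for (DE1), (DE3), (DE4) there are tight double-exponential translations, and for (E4), (E5) there are tight root-exponential translations (so the blow-up is at most $2^{O(n)}$, and it is $2^{\Omega(\sqrt n)}$ on an infinite family). -/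

import Mathlib

open Filter

namespace SizeTradeoff

universe u v

/-! ### Context-free grammars: derivation trees, unambiguity, size -/

/-- Ordered forests of complete derivation trees of the grammar `g` whose sequence of root labels
is the given list of symbols. A tree whose root is a terminal is a leaf; a tree whose root is a
nonterminal `A` consists of a rule `A → α` of `g` and a forest with root labels `α`. -/
inductive Forest {V : Type u} (g : ContextFreeGrammar.{u} V) :
    List (Symbol V g.NT) → Type u
  | nil : Forest g []
  | terminal (a : V) {l : List (Symbol V g.NT)} (rest : Forest g l) :
      Forest g (Symbol.terminal a :: l)
  | nonterminal (r : ContextFreeRule V g.NT) (hr : r ∈ g.rules) {l : List (Symbol V g.NT)}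
      (children : Forest g r.output) (rest : Forest g l) :
      Forest g (Symbol.nonterminal r.input :: l)

/-- The word of terminals at the leaves of a forest, read from left to right. -/
def Forest.yield {V : Type u} {g : ContextFreeGrammar.{u} V} :
    {l : List (Symbol V g.NT)} → Forest g l → List V
  | _, .nil => []
  | _, .terminal a rest => a :: rest.yield
  | _, .nonterminal _ _ children rest => children.yield ++ rest.yield

/-- Complete derivation trees of `g` whose root is the start symbol. -/
abbrev DerivationTree {V : Type u} (g : ContextFreeGrammar.{u} V) : Type u :=
  Forest g [Symbol.nonterminal g.initial]

/-- A grammar is unambiguous if each word has at most one derivation tree. -/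
def GrammarUnambiguous {V : Type u} (g : ContextFreeGrammar.{u} V) : Prop :=
  ∀ t t' : DerivationTree g, t.yield = t'.yield → t = t'

/-- Symbols plus operators in a concatenation: the empty concatenation is the single symbol `ε`,
and `k ≥ 1` symbols are joined by `k - 1` concatenation operators. -/
def concatSize {S : Type u} (α : List S) : ℕ :=
  if α.length = 0 then 1 else 2 * α.length - 1

/-- The size of a context-free grammar: the number of occurrences of symbols and operators in the
right-hand sides, where the `m` productions of a nonterminal are written as one rule
`A → α₁ ∪ ⋯ ∪ αₘ` and hence need `m - 1` union operators. -/
noncomputable def grammarSize {V : Type u} (g : ContextFreeGrammar.{u} V) : ℕ :=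
  (∑ r ∈ g.rules, concatSize r.output) +
    (g.rules.card - (ContextFreeRule.input '' (g.rules : Set (ContextFreeRule V g.NT))).ncard)

/-! ### Finite automata -/

/-- A nondeterministic finite automaton with symbols from `V`: finitely many states and finitely
many transitions, so that its alphabet is the finite set of symbols on its transitions. -/
structure FinAutomaton (V : Type u) where
  State : Type
  finite_state : Finite State
  nfa : NFA V State
  finite_transitions : {t : State × V × State | t.2.2 ∈ nfa.step t.1 t.2.1}.Finite

/-- The size of an automaton: number of states plus number of transitions. -/
noncomputable def FinAutomaton.size {V : Type u} (A : FinAutomaton V) : ℕ :=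
  Nat.card A.State + {t : A.State × V × A.State | t.2.2 ∈ A.nfa.step t.1 t.2.1}.ncard

/-- An automaton is unambiguous if each word has at most one accepting run. -/
def FinAutomaton.Unambiguous {V : Type u} (A : FinAutomaton V) : Prop :=
  ∀ w : List V, Subsingleton (Σ (s : A.nfa.start) (t : A.nfa.accept), A.nfa.Path s t w)

/-- An automaton is deterministic if it has exactly one initial state and, for each state and
symbol, at most one successor state. -/
def FinAutomaton.Deterministic {V : Type u} (A : FinAutomaton V) : Prop :=
  (∃ s, A.nfa.start = {s}) ∧ ∀ q a, (A.nfa.step q a).Subsingleton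

/-! ### Representation models -/

/-- A model for representing languages over `V`: a class of objects, each of which has a language
and a size. -/
structure Model (V : Type u) where
  Obj : Type v
  lang : Obj → Language V
  size : Obj → ℕ

/-- Context-free grammars. -/
noncomputable def CFGs (V : Type u) : Model V where
  Obj := ContextFreeGrammar.{u} V
  lang g := g.language
  size g := grammarSize g

/-- Unambiguous context-free grammars. -/
noncomputable def UCFGs (V : Type u) : Model V where
  Obj := {g : ContextFreeGrammar.{u} V // GrammarUnambiguous g}
  lang g := g.1.language
  size g := grammarSize g.1

/-- Nondeterministic finite automata. -/
noncomputable def NFAs (V : Type u) : Model V where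
  Obj := FinAutomaton V
  lang A := A.nfa.accepts
  size A := A.size

/-- Unambiguous finite automata. -/
noncomputable def UFAs (V : Type u) : Model V where
  Obj := {A : FinAutomaton V // A.Unambiguous}
  lang A := A.1.nfa.accepts
  size A := A.1.size

/-- Deterministic finite automata. -/
noncomputable def DFAs (V : Type u) : Model V where
  Obj := {A : FinAutomaton V // A.Deterministic}
  lang A := A.1.nfa.accepts
  size A := A.1.size

/-- Finite sets of words, listed explicitly. The size is the total length of the words, plus one
for each word. -/
def WordSets (V : Type u) : Model V where
  Obj := Finset (List V)
  lang S := {w | w ∈ S}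
  size S := ∑ w ∈ S, (w.length + 1)

/-! ### Translations over uniform-length languages -/

/-- All words of the language have the same length. -/
def UniformLength {V : Type u} (L : Language V) : Prop :=
  ∃ k : ℕ, ∀ w ∈ L, w.length = k

/-- There is an `f(n)`-size translation from `X` to `Y` over uniform-length languages: each object
of size `n` has an equivalent object of size `O(f(n))`. -/
def SizeTranslation {V : Type u} (f : ℕ → ℝ) (X Y : Model V) : Prop :=
  ∃ C : ℝ, ∀ x : X.Obj, UniformLength (X.lang x) →
    ∃ y : Y.Obj, Y.lang y = X.lang x ∧ (Y.size y : ℝ) ≤ C * f (X.size x)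

/-- There is an infinite family of objects of `X` with uniform-length languages, of unboundedly
increasing sizes, such that for each object of size `n` in the family, every equivalent object
of `Y` has size `Ω(f(n))`. -/
def LowerBoundFamily {V : Type u} (f : ℕ → ℝ) (X Y : Model V) : Prop :=
  ∃ x : ℕ → X.Obj, StrictMono (fun i => X.size (x i)) ∧ (∀ i, UniformLength (X.lang (x i))) ∧
    ∃ c : ℝ, 0 < c ∧ ∀ i, ∀ y : Y.Obj, Y.lang y = X.lang (x i) →
      c * f (X.size (x i)) ≤ (Y.size y : ℝ)

/-- There is an `F`-translation: an `f(n)`-size translation for some `f ∈ F`. -/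
def HasTranslation {V : Type u} (F : Set (ℕ → ℝ)) (X Y : Model V) : Prop :=
  ∃ f ∈ F, SizeTranslation f X Y

/-- There is a tight `F`-translation: for some `f ∈ F` there is an `f(n)`-size translation, and
there is an infinite family of objects witnessing that `f(n)` cannot be improved. -/
def HasTightTranslation {V : Type u} (F : Set (ℕ → ℝ)) (X Y : Model V) : Prop :=
  ∃ f ∈ F, SizeTranslation f X Y ∧ LowerBoundFamily f X Y

/-- Exponential functions: `2 ^ Θ(n)`. -/
def Exponential : Set (ℕ → ℝ) :=
  {f | ∃ c C : ℝ, 0 < c ∧ ∀ᶠ n : ℕ in atTop,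
    (2 : ℝ) ^ (c * n) ≤ f n ∧ f n ≤ (2 : ℝ) ^ (C * n)}

/-- Functions that are at least `2 ^ Ω(√n)` and at most `2 ^ O(n)`. -/
def RootExponential : Set (ℕ → ℝ) :=
  {f | ∃ c C : ℝ, 0 < c ∧ ∀ᶠ n : ℕ in atTop,
    (2 : ℝ) ^ (c * √(n : ℝ)) ≤ f n ∧ f n ≤ (2 : ℝ) ^ (C * n)}

/-- Double-exponential functions: `2 ^ 2 ^ Θ(n)`. -/
def DoubleExponential : Set (ℕ → ℝ) :=
  {f | ∃ c C : ℝ, 0 < c ∧ ∀ᶠ n : ℕ in atTop,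
    (2 : ℝ) ^ ((2 : ℝ) ^ (c * n)) ≤ f n ∧ f n ≤ (2 : ℝ) ^ ((2 : ℝ) ^ (C * n))}

end SizeTradeoff

/-!
For a uniform-length language, everything that is glued together from pieces of accepting runs or
of derivation trees has to have the right length again. This gives the upper bounds.

* *Automata to word sets.* A transition occurs at only one position of accepting runs
  (`index_unique`), so that a word is determined by the set of transitions of one of its runs: an
  automaton of size `n` accepts at most `2 ^ n` words, of length at most `n`
  (`expBounded_NFAs_WordSets`). In the converse direction a trie is a deterministic automaton of
  linear size (`linearBounded_WordSets_DFAs`), and a list of words is an unambiguous grammar of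
  linear size (`linearBounded_WordSets_UCFGs`). All translations out of automata go through word
  sets.
* *Grammars to automata.* If a nonterminal occurs below itself in a derivation tree, both
  occurrences have the same yield, so each word has a tree without such repetitions
  (`Forest.exists_repetitionFree`). The automaton `stackNFA` guesses a leftmost derivation and
  stores the part of the sentential form that is still to be read. Along paths without repetitions
  there are at most `∏ A, (1 + ruleLength g A) ≤ 2 ^ n` such stacks (`exists_finset_isStack`). Runs
  correspond to derivation trees, so the automaton of an unambiguous grammar is unambiguous
  (`stackNFA_runUnique`). The double-exponential bounds are compositions of these two steps.

The lower bounds, except those for automata versus word sets, come from one family of languages,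
`probeLanguage`. A word consists of a block of `N` letters `z` and `o`, followed by a further part
that selects one position `i < N` of the block; the word belongs to the language if the selected
letter is `o`. There are grammars of size `O(log N)` (`probeGrammar`) and automata of size
`O(N ^ 2)` (`exists_finAutomaton_layered`) for it.

* If the selection is made by a separate letter `d` at position `i + N + 1`, then the grammar and
  the automaton are unambiguous, but a deterministic automaton has to remember the whole block
  (`probeLanguage_dfa_lower`).
* If all letters are `z` or `o`, the language contains the set intersection problem. An unambiguous
  automaton with `s` states factors the intersection matrix through a space of dimension `s`, and
  that matrix has rank at least `2 ^ N - 1` (`probeLanguage_ufa_lower`).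
* The languages have at least `2 ^ N` words (`probeLanguage_wordSets_lower`), and these have length
  `2 * N + 1`, which is a lower bound for the size of any automaton (`probeLanguage_nfa_lower`).

Finally, a translation of size `U` and a family that needs size `Lo` give a tight translation for
some function between `Lo` and `U`, namely the maximum of `Lo` and the worst case over all objects
of a given size (`exists_tight`).
-/

open Filter

namespace SizeTradeoff

universe u v v' v'' w

/-! ### Forests and the language of a grammar -/

section Forests

variable {V : Type u} {g : ContextFreeGrammar.{u} V}

/-- Juxtaposition of two forests. -/
def Forest.append : {l l' : List (Symbol V g.NT)} → Forest g l → Forest g l' → Forest g (l ++ l')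
  | _, _, .nil, t' => t'
  | _, _, .terminal a rest, t' => .terminal a (rest.append t')
  | _, _, .nonterminal r hr ch rest, t' => .nonterminal r hr ch (rest.append t')

@[simp]
theorem Forest.yield_append {l l' : List (Symbol V g.NT)} (t : Forest g l) (t' : Forest g l') :
    (t.append t').yield = t.yield ++ t'.yield := by
  induction t with
  | nil => rfl
  | terminal a rest ih => simp [append, yield, ih]
  | nonterminal r hr ch rest _ ih => simp [append, yield, ih]

theorem Forest.exists_eq_append {l l' : List (Symbol V g.NT)} (t : Forest g (l ++ l')) :
    ∃ (t₁ : Forest g l) (t₂ : Forest g l'), t = t₁.append t₂ := by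
  induction l with
  | nil => exact ⟨.nil, t, rfl⟩
  | cons x l ih =>
    change Forest g (x :: (l ++ l')) at t
    cases t with
    | terminal a rest =>
      obtain ⟨t₁, t₂, rfl⟩ := ih rest
      exact ⟨.terminal a t₁, t₂, rfl⟩
    | nonterminal r hr ch rest =>
      obtain ⟨t₁, t₂, rfl⟩ := ih rest
      exact ⟨.nonterminal r hr ch t₁, t₂, rfl⟩

/-- The words of terminals that the sentential form `l` generates. -/
def formLanguage (g : ContextFreeGrammar.{u} V) (l : List (Symbol V g.NT)) : Language V :=
  {w | ∃ t : Forest g l, t.yield = w}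

theorem mem_formLanguage {l : List (Symbol V g.NT)} {w : List V} :
    w ∈ formLanguage g l ↔ ∃ t : Forest g l, t.yield = w := Iff.rfl

theorem formLanguage_nil : formLanguage g [] = 1 := by
  ext w
  rw [mem_formLanguage, Language.mem_one]
  constructor
  · rintro ⟨t, rfl⟩
    cases t
    rfl
  · rintro rfl
    exact ⟨.nil, rfl⟩

theorem formLanguage_append (l l' : List (Symbol V g.NT)) :
    formLanguage g (l ++ l') = formLanguage g l * formLanguage g l' := by
  ext w
  rw [mem_formLanguage, Language.mem_mul]
  constructor
  · rintro ⟨t, rfl⟩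
    obtain ⟨t₁, t₂, rfl⟩ := t.exists_eq_append
    exact ⟨_, ⟨t₁, rfl⟩, _, ⟨t₂, rfl⟩, (Forest.yield_append t₁ t₂).symm⟩
  · rintro ⟨_, ⟨t₁, rfl⟩, _, ⟨t₂, rfl⟩, rfl⟩
    exact ⟨t₁.append t₂, Forest.yield_append t₁ t₂⟩

theorem formLanguage_terminal (a : V) : formLanguage g [Symbol.terminal a] = {[a]} := by
  ext w
  constructor
  · rintro ⟨t, rfl⟩
    cases t with
    | terminal a rest => cases rest; rfl
  · rintro rfl
    exact ⟨.terminal a .nil, rfl⟩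

theorem mem_formLanguage_nonterminal {A : g.NT} {w : List V} :
    w ∈ formLanguage g [Symbol.nonterminal A] ↔
      ∃ r ∈ g.rules, r.input = A ∧ w ∈ formLanguage g r.output := by
  constructor
  · rintro ⟨t, rfl⟩
    cases t with
    | nonterminal r hr ch rest =>
      cases rest
      exact ⟨r, hr, rfl, ch, by simp [Forest.yield]⟩
  · rintro ⟨r, hr, rfl, ch, rfl⟩
    exact ⟨.nonterminal r hr ch .nil, by simp [Forest.yield]⟩

theorem formLanguage_cons (x : Symbol V g.NT) (l : List (Symbol V g.NT)) :
    formLanguage g (x :: l) = formLanguage g [x] * formLanguage g l :=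
  formLanguage_append [x] l

theorem formLanguage_map_terminal (w : List V) :
    formLanguage g (w.map Symbol.terminal) = {w} := by
  induction w with
  | nil => exact formLanguage_nil
  | cons a w ih =>
    rw [List.map_cons, formLanguage_cons, ih, formLanguage_terminal]
    ext w'
    rw [Language.mem_mul]
    constructor
    · rintro ⟨_, rfl, _, rfl, rfl⟩
      rfl
    · rintro rfl
      exact ⟨_, rfl, _, rfl, rfl⟩

/-- The leftmost derivation that belongs to a forest. -/
theorem Forest.derives_yield {l : List (Symbol V g.NT)} (t : Forest g l) :
    g.Derives l (t.yield.map Symbol.terminal) := by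
  induction t with
  | nil => exact Relation.ReflTransGen.refl
  | terminal a rest ih => exact ih.append_left [Symbol.terminal a]
  | @nonterminal r hr l ch rest ihc ihr =>
    have h1 : g.Produces (Symbol.nonterminal r.input :: l) (r.output ++ l) :=
      ⟨r, hr, ContextFreeRule.Rewrites.head l⟩
    rw [yield, List.map_append]
    exact h1.trans_derives ((ihc.append_right l).trans (ihr.append_left _))

theorem formLanguage_mono_of_produces {l l' : List (Symbol V g.NT)} (h : g.Produces l l')
    {w : List V} (hw : w ∈ formLanguage g l') : w ∈ formLanguage g l := by
  obtain ⟨r, hr, h⟩ := h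
  obtain ⟨p, q, rfl, rfl⟩ := h.exists_parts
  rw [formLanguage_append, Language.mem_mul] at hw ⊢
  obtain ⟨w₁, hw₁, w₂, hw₂, rfl⟩ := hw
  refine ⟨w₁, ?_, w₂, hw₂, rfl⟩
  rw [formLanguage_append, Language.mem_mul] at hw₁ ⊢
  obtain ⟨w₃, hw₃, w₄, hw₄, rfl⟩ := hw₁
  exact ⟨w₃, hw₃, w₄, mem_formLanguage_nonterminal.2 ⟨r, hr, rfl, hw₄⟩, rfl⟩

theorem formLanguage_mono_of_derives {l l' : List (Symbol V g.NT)} (h : g.Derives l l')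
    {w : List V} (hw : w ∈ formLanguage g l') : w ∈ formLanguage g l := by
  induction h with
  | refl => exact hw
  | tail _ h ih => exact ih (formLanguage_mono_of_produces h hw)

theorem language_eq_formLanguage (g : ContextFreeGrammar.{u} V) :
    g.language = formLanguage g [Symbol.nonterminal g.initial] := by
  ext w
  constructor
  · intro h
    refine formLanguage_mono_of_derives h ?_
    rw [formLanguage_map_terminal]
    rfl
  · rintro ⟨t, rfl⟩
    exact t.derives_yield

/-- Soundness of an interpretation `I` of the nonterminals by languages that is closed under the
rules. -/
theorem mem_prod_of_mem_formLanguage (I : g.NT → Language V) (J : Symbol V g.NT → Language V)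
    (hJt : ∀ a, J (.terminal a) = {[a]}) (hJn : ∀ A, J (.nonterminal A) = I A)
    (h : ∀ r ∈ g.rules, ∀ w ∈ (r.output.map J).prod, w ∈ I r.input) {l : List (Symbol V g.NT)}
    {w : List V} (hw : w ∈ formLanguage g l) : w ∈ (l.map J).prod := by
  obtain ⟨t, rfl⟩ := hw
  induction t with
  | nil => exact Language.nil_mem_one
  | terminal a rest ih =>
    rw [List.map_cons, List.prod_cons, hJt]
    exact Language.mem_mul.2 ⟨[a], rfl, _, ih, rfl⟩
  | nonterminal r hr ch rest ihc ihr =>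
    rw [List.map_cons, List.prod_cons, hJn]
    exact Language.append_mem_mul (h r hr _ ihc) ihr

/-- If every nonterminal generates words of only one length, and different rules of a nonterminal
generate disjoint languages, then a forest is determined by its root labels and its yield. -/
theorem Forest.eq_of_yield_eq
    (hlen : ∀ A : g.NT, UniformLength (formLanguage g [Symbol.nonterminal A]))
    (hdisj : ∀ r ∈ g.rules, ∀ r' ∈ g.rules, r.input = r'.input → ∀ w,
      w ∈ formLanguage g r.output → w ∈ formLanguage g r'.output → r = r')
    {l : List (Symbol V g.NT)} (t t' : Forest g l) (h : t.yield = t'.yield) : t = t' := by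
  induction t with
  | nil => cases t'; rfl
  | terminal a rest ih =>
    cases t' with
    | terminal a rest' => rw [ih rest' (List.cons_injective h)]
  | nonterminal r hr ch rest ihc ihr =>
    obtain ⟨A, β⟩ := r
    cases t' with
    | nonterminal r' hr' ch' rest' =>
      obtain ⟨k, hk⟩ := hlen r'.input
      have h1 : ch.yield.length = k := hk _ (mem_formLanguage_nonterminal.2 ⟨_, hr, rfl, ch, rfl⟩)
      have h2 : ch'.yield.length = k :=
        hk _ (mem_formLanguage_nonterminal.2 ⟨_, hr', rfl, ch', rfl⟩)
      obtain ⟨h3, h4⟩ := List.append_inj h (h1.trans h2.symm)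
      have h5 := hdisj _ hr _ hr' rfl ch.yield ⟨ch, rfl⟩ ⟨ch', h3.symm⟩
      obtain ⟨A', β'⟩ := r'
      obtain rfl : β = β' := by simpa using h5
      rw [ihc ch' h3, ihr rest' h4]

end Forests

/-! ### From explicit bounds to translations and tight translations -/

section Bounds

variable {V : Type u} {X : Model.{u, v} V} {Y : Model.{u, v'} V}

/-- Each object of `X` of size `n` with a uniform-length language has an equivalent object of `Y`
of size at most `U n`. -/
def BoundedBy (U : ℕ → ℕ) (X : Model.{u, v} V) (Y : Model.{u, v'} V) : Prop :=
  ∀ x : X.Obj, UniformLength (X.lang x) →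
    ∃ y : Y.Obj, Y.lang y = X.lang x ∧ Y.size y ≤ U (X.size x)

/-- A bound `2 ^ O(n)` on the size of equivalent objects. -/
def ExpBounded (X : Model.{u, v} V) (Y : Model.{u, v'} V) : Prop :=
  ∃ C : ℕ, BoundedBy (fun n => 2 ^ (C * (n + 1))) X Y

/-- A bound `2 ^ 2 ^ O(n)` on the size of equivalent objects. -/
def DoubleExpBounded (X : Model.{u, v} V) (Y : Model.{u, v'} V) : Prop :=
  ∃ C : ℕ, BoundedBy (fun n => 2 ^ 2 ^ (C * (n + 1))) X Y

theorem BoundedBy.mono {U U' : ℕ → ℕ} (h : BoundedBy U X Y) (hU : ∀ n, U n ≤ U' n) :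
    BoundedBy U' X Y := fun x hx =>
  let ⟨y, hy, hs⟩ := h x hx
  ⟨y, hy, hs.trans (hU _)⟩

theorem BoundedBy.sizeTranslation {U : ℕ → ℕ} (h : BoundedBy U X Y) :
    SizeTranslation (fun n => (U n : ℝ)) X Y :=
  ⟨1, fun x hx =>
    let ⟨y, hy, hs⟩ := h x hx
    ⟨y, hy, by rw [one_mul]; exact Nat.cast_le.2 hs⟩⟩

/-- The size of a smallest object of `Y` that is equivalent to `x`. -/
noncomputable def minSize (Y : Model.{u, v'} V) (x : X.Obj) : ℕ :=
  sInf {s | ∃ y : Y.Obj, Y.lang y = X.lang x ∧ Y.size y = s}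

theorem minSize_le {x : X.Obj} {y : Y.Obj} (h : Y.lang y = X.lang x) :
    minSize Y x ≤ Y.size y :=
  Nat.sInf_le ⟨y, h, rfl⟩

theorem exists_size_eq_minSize {x : X.Obj} (h : ∃ y : Y.Obj, Y.lang y = X.lang x) :
    ∃ y : Y.Obj, Y.lang y = X.lang x ∧ Y.size y = minSize Y x :=
  let ⟨y, hy⟩ := h
  Nat.sInf_mem (s := {s | ∃ y : Y.Obj, Y.lang y = X.lang x ∧ Y.size y = s}) ⟨_, y, hy, rfl⟩

/-- An upper bound `U` and a family with lower bound `Lo` give a function between the two that is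
attained up to constants: the larger of `Lo n` and the worst case over all objects of size `n`. -/
theorem exists_tight {U : ℕ → ℕ} (hU : BoundedBy U X Y) (Lo : ℕ → ℝ) (x : ℕ → X.Obj)
    (hx : ∀ m, UniformLength (X.lang (x m)))
    (hlo : ∀ m (y : Y.Obj), Y.lang y = X.lang (x m) → Lo (X.size (x m)) ≤ Y.size y)
    (hm : ∀ m (y : Y.Obj), Y.lang y = X.lang (x m) → m ≤ Y.size y) :
    ∃ f : ℕ → ℝ, (∀ n, Lo n ≤ f n) ∧ (∀ n, f n ≤ max (Lo n) (U n)) ∧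
      SizeTranslation f X Y ∧ LowerBoundFamily f X Y := by
  set S : ℕ → Set ℕ := fun n =>
    {s | ∃ z : X.Obj, UniformLength (X.lang z) ∧ X.size z = n ∧ minSize Y z = s} with hS
  have hSU : ∀ n, ∀ s ∈ S n, s ≤ U n := by
    rintro _ _ ⟨z, hz, rfl, rfl⟩
    obtain ⟨y, hy, hs⟩ := hU z hz
    exact (minSize_le hy).trans hs
  have hbdd : ∀ n, BddAbove (S n) := fun n => ⟨U n, hSU n⟩
  refine ⟨fun n => max (Lo n) (sSup (S n) : ℕ), fun n => le_max_left _ _, fun n => ?_, ?_, ?_⟩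
  · refine max_le_max le_rfl ?_
    rcases (S n).eq_empty_or_nonempty with h | h
    · rw [h]; simp
    · exact_mod_cast hSU n _ (Nat.sSup_mem h (hbdd n))
  · refine ⟨1, fun z hz => ?_⟩
    obtain ⟨y, hy, -⟩ := hU z hz
    obtain ⟨y, hy, hs⟩ := exists_size_eq_minSize ⟨y, hy⟩
    refine ⟨y, hy, ?_⟩
    rw [one_mul, hs]
    refine le_trans ?_ (le_max_right _ _)
    exact_mod_cast le_csSup (hbdd _) ⟨z, hz, rfl, rfl⟩
  · -- The sizes of the family tend to infinity, because objects of bounded size have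
    -- equivalent objects of bounded size.
    have htend : Tendsto (fun m => X.size (x m)) atTop atTop := by
      refine tendsto_atTop.2 fun b => ?_
      filter_upwards [eventually_gt_atTop (∑ i ∈ Finset.range b, U i)] with m hmb
      by_contra! hlt
      obtain ⟨y, hy, hs⟩ := hU (x m) (hx m)
      have h1 := hm m y hy
      have h2 : U (X.size (x m)) ≤ ∑ i ∈ Finset.range b, U i :=
        Finset.single_le_sum (f := U) (fun _ _ => Nat.zero_le _) (Finset.mem_range.2 hlt)
      omega
    obtain ⟨φ, -, hφ⟩ := strictMono_subseq_of_tendsto_atTop htend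
    have hne : ∀ i, (S (X.size (x (φ i)))).Nonempty := fun i => ⟨_, x (φ i), hx _, rfl, rfl⟩
    choose z hz1 hz2 hz3 using fun i => Nat.sSup_mem (hne i) (hbdd _)
    refine ⟨z, fun i j hij => ?_, hz1, 1, one_pos, fun i y hy => ?_⟩
    · have := hφ hij
      simp only [hz2]
      exact this
    · rw [one_mul, hz2]
      refine max_le ?_ ?_
      · obtain ⟨y', hy', -⟩ := hU (x (φ i)) (hx _)
        obtain ⟨y', hy', hs⟩ := exists_size_eq_minSize ⟨y', hy'⟩
        refine (hlo _ y' hy').trans ?_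
        have : Y.size y' ≤ Y.size y := by
          rw [hs]
          refine le_trans ?_ (minSize_le hy)
          rw [hz3]
          exact le_csSup (hbdd _) ⟨x (φ i), hx _, rfl, rfl⟩
        exact_mod_cast this
      · rw [← hz3 i]
        exact_mod_cast minSize_le hy

theorem HasTightTranslation.hasTranslation {F : Set (ℕ → ℝ)} (h : HasTightTranslation F X Y) :
    HasTranslation F X Y :=
  let ⟨f, hf, h, _⟩ := h
  ⟨f, hf, h⟩

theorem mem_exponential {f : ℕ → ℝ} {C D : ℕ} (hC : 0 < C)
    (h1 : ∀ n : ℕ, (2 : ℝ) ^ ((n : ℝ) / C - 2) ≤ f n)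
    (h2 : ∀ n : ℕ, f n ≤ (2 : ℝ) ^ ((D * (n + 1) : ℕ) : ℝ)) : f ∈ Exponential := by
  have hC' : (0 : ℝ) < C := by exact_mod_cast hC
  refine ⟨1 / (2 * C), 2 * D, by positivity, ?_⟩
  filter_upwards [eventually_ge_atTop (4 * C + 1)] with n hn
  have hn' : (4 * C + 1 : ℝ) ≤ n := by exact_mod_cast hn
  refine ⟨le_trans ?_ (h1 n), (h2 n).trans ?_⟩
  · refine Real.rpow_le_rpow_of_exponent_le one_le_two ?_
    have : (n : ℝ) / C - 2 - 1 / (2 * C) * n = (n - 4 * C) / (2 * C) := by field_simp; ring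
    have h3 : (0 : ℝ) ≤ (n - 4 * C) / (2 * C) := div_nonneg (by linarith) (by positivity)
    linarith
  · refine Real.rpow_le_rpow_of_exponent_le one_le_two ?_
    push_cast
    have : (D : ℝ) * 1 ≤ D * n := mul_le_mul_of_nonneg_left (by linarith) (Nat.cast_nonneg _)
    linarith

theorem mem_rootExponential {f : ℕ → ℝ} {C D : ℕ} (hC : 0 < C)
    (h1 : ∀ n : ℕ, (2 : ℝ) ^ (√(n : ℝ) / C - 2) ≤ f n)
    (h2 : ∀ n : ℕ, f n ≤ (2 : ℝ) ^ ((D * (n + 1) : ℕ) : ℝ)) : f ∈ RootExponential := by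
  have hC' : (0 : ℝ) < C := by exact_mod_cast hC
  refine ⟨1 / (2 * C), 2 * D, by positivity, ?_⟩
  filter_upwards [eventually_ge_atTop ((4 * C) ^ 2 + 1)] with n hn
  have hn' : (((4 * C) ^ 2 + 1 : ℕ) : ℝ) ≤ n := by exact_mod_cast hn
  push_cast at hn'
  refine ⟨le_trans ?_ (h1 n), (h2 n).trans ?_⟩
  · refine Real.rpow_le_rpow_of_exponent_le one_le_two ?_
    have h4 : (4 * C : ℝ) ≤ √n := Real.le_sqrt_of_sq_le (by linarith)
    have : √(n : ℝ) / C - 2 - 1 / (2 * C) * √n = (√n - 4 * C) / (2 * C) := by field_simp; ring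
    have h3 : (0 : ℝ) ≤ (√n - 4 * C) / (2 * C) := div_nonneg (by linarith) (by positivity)
    linarith
  · refine Real.rpow_le_rpow_of_exponent_le one_le_two ?_
    push_cast
    have : (D : ℝ) * 1 ≤ D * n :=
      mul_le_mul_of_nonneg_left (by nlinarith [sq_nonneg (4 * (C : ℝ))]) (Nat.cast_nonneg _)
    linarith

theorem mem_doubleExponential {f : ℕ → ℝ} {C D : ℕ} (hC : 0 < C)
    (h1 : ∀ n : ℕ, (2 : ℝ) ^ ((2 : ℝ) ^ ((n : ℝ) / C - 1) - 1) ≤ f n)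
    (h2 : ∀ n : ℕ, f n ≤ (2 : ℝ) ^ ((2 : ℝ) ^ ((D * (n + 1) : ℕ) : ℝ))) :
    f ∈ DoubleExponential := by
  have hC' : (0 : ℝ) < C := by exact_mod_cast hC
  refine ⟨1 / (2 * C), 2 * D, by positivity, ?_⟩
  filter_upwards [eventually_ge_atTop (4 * C + 1)] with n hn
  have hn' : (4 * C + 1 : ℝ) ≤ n := by exact_mod_cast hn
  refine ⟨le_trans ?_ (h1 n), (h2 n).trans ?_⟩
  · refine Real.rpow_le_rpow_of_exponent_le one_le_two ?_
    -- With `a = 2 ^ (n / 2C) ≥ 4`, this is `a ≤ a ^ 2 / 2 - 1`.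
    set a : ℝ := (2 : ℝ) ^ (1 / (2 * C) * (n : ℝ)) with ha
    have h3 : (2 : ℝ) ^ ((n : ℝ) / C - 1) = a * a / 2 := by
      rw [Real.rpow_sub two_pos, Real.rpow_one, ha, ← Real.rpow_add two_pos]
      congr 2
      field_simp
      ring
    have h4 : (4 : ℝ) ≤ a := by
      have h5 : (2 : ℝ) ≤ 1 / (2 * C) * (n : ℝ) := by
        rw [div_mul_eq_mul_div, one_mul, le_div_iff₀ (by positivity)]
        linarith
      calc (4 : ℝ) = (2 : ℝ) ^ (2 : ℝ) := by norm_num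
        _ ≤ a := Real.rpow_le_rpow_of_exponent_le one_le_two h5
    rw [h3]
    nlinarith
  · refine Real.rpow_le_rpow_of_exponent_le one_le_two ?_
    refine Real.rpow_le_rpow_of_exponent_le one_le_two ?_
    push_cast
    have : (D : ℝ) * 1 ≤ D * n := mul_le_mul_of_nonneg_left (by linarith) (Nat.cast_nonneg _)
    linarith

theorem ExpBounded.exists_pos (h : ExpBounded X Y) :
    ∃ C : ℕ, 0 < C ∧ BoundedBy (fun n => 2 ^ (C * (n + 1))) X Y :=
  let ⟨C, hC⟩ := h
  ⟨C + 1, C.succ_pos, hC.mono fun _ => Nat.pow_le_pow_right two_pos (by gcongr; omega)⟩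

theorem DoubleExpBounded.exists_pos (h : DoubleExpBounded X Y) :
    ∃ C : ℕ, 0 < C ∧ BoundedBy (fun n => 2 ^ 2 ^ (C * (n + 1))) X Y :=
  let ⟨C, hC⟩ := h
  ⟨C + 1, C.succ_pos, hC.mono fun _ => Nat.pow_le_pow_right two_pos
    (Nat.pow_le_pow_right two_pos (by gcongr; omega))⟩

theorem le_mul_succ_cast {D : ℕ} (hD : 0 < D) (n : ℕ) : (n : ℝ) ≤ ((D * (n + 1) : ℕ) : ℝ) := by
  have : n ≤ D * (n + 1) := by nlinarith
  exact_mod_cast this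

theorem cast_two_pow (k : ℕ) : ((2 ^ k : ℕ) : ℝ) = (2 : ℝ) ^ (k : ℝ) := by
  rw [Real.rpow_natCast]; norm_cast

theorem cast_two_pow_two_pow (k : ℕ) : ((2 ^ 2 ^ k : ℕ) : ℝ) = (2 : ℝ) ^ ((2 : ℝ) ^ (k : ℝ)) := by
  rw [cast_two_pow, cast_two_pow]

theorem ExpBounded.hasTranslation (h : ExpBounded X Y) : HasTranslation Exponential X Y := by
  obtain ⟨D, hD, h⟩ := h.exists_pos
  refine ⟨_, mem_exponential (C := 1) (D := D) one_pos (fun n => ?_) (fun n => ?_),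
    h.sizeTranslation⟩
  · rw [cast_two_pow]
    refine Real.rpow_le_rpow_of_exponent_le one_le_two ?_
    have := le_mul_succ_cast hD n
    rw [Nat.cast_one, div_one]
    linarith
  · rw [cast_two_pow]

theorem DoubleExpBounded.hasTranslation (h : DoubleExpBounded X Y) :
    HasTranslation DoubleExponential X Y := by
  obtain ⟨D, hD, h⟩ := h.exists_pos
  refine ⟨_, mem_doubleExponential (C := 1) (D := D) one_pos (fun n => ?_) (fun n => ?_),
    h.sizeTranslation⟩
  · rw [cast_two_pow_two_pow]
    refine Real.rpow_le_rpow_of_exponent_le one_le_two ?_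
    have h1 := le_mul_succ_cast hD n
    have h2 : (2 : ℝ) ^ ((n : ℝ) / (1 : ℕ) - 1) ≤ (2 : ℝ) ^ ((D * (n + 1) : ℕ) : ℝ) := by
      refine Real.rpow_le_rpow_of_exponent_le one_le_two ?_
      rw [Nat.cast_one, div_one]
      linarith
    linarith
  · rw [cast_two_pow_two_pow]

theorem div_sub_one_le {C m s : ℕ} (hC : 0 < C) (h : s ≤ C * (m + 1)) :
    (s : ℝ) / C - 1 ≤ m := by
  have hC' : (0 : ℝ) < C := by exact_mod_cast hC
  have h' : (s : ℝ) ≤ C * (m + 1) := by exact_mod_cast h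
  rw [sub_le_iff_le_add, div_le_iff₀ hC']
  linarith

theorem two_rpow_sub_le {t : ℝ} {m s : ℕ} (ht : t - 1 ≤ m) (hs : 2 ^ m ≤ s + 1) (hs' : m ≤ s)
    (hm : 0 < m) : (2 : ℝ) ^ (t - 2) ≤ s := by
  have h1 : (2 : ℝ) ^ (t - 2) ≤ (2 : ℝ) ^ ((m : ℝ) - 1) :=
    Real.rpow_le_rpow_of_exponent_le one_le_two (by linarith)
  have h2 : (2 : ℝ) ^ ((m : ℝ) - 1) = 2 ^ m / 2 := by
    rw [Real.rpow_sub two_pos, Real.rpow_one, Real.rpow_natCast]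
  have h3 : (2 : ℝ) ^ m ≤ s + 1 := by exact_mod_cast hs
  have h4 : (1 : ℝ) ≤ s := by exact_mod_cast hm.trans_le hs'
  linarith

/-- An upper bound `2 ^ O(n)` is tight if there is a family of objects of size `O(m)` whose
equivalent objects have size `2 ^ m - 1` at least. -/
theorem ExpBounded.hasTightTranslation (h : ExpBounded X Y) {C : ℕ} (hC : 0 < C) (x : ℕ → X.Obj)
    (hx : ∀ m, UniformLength (X.lang (x m))) (hs : ∀ m, X.size (x m) ≤ C * (m + 1))
    (hy : ∀ m (y : Y.Obj), Y.lang y = X.lang (x m) → 2 ^ m ≤ Y.size y + 1) :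
    HasTightTranslation Exponential X Y := by
  obtain ⟨D, hD, h⟩ := h.exists_pos
  have hy' : ∀ m (y : Y.Obj), Y.lang y = X.lang (x m) → m ≤ Y.size y := fun m y e => by
    have h1 := hy m y e
    have h2 := Nat.lt_two_pow_self (n := m)
    omega
  -- The member `x 0` is dropped, since `2 ^ 0 - 1 = 0` is not positive.
  obtain ⟨f, h1, h2, h3, h4⟩ := exists_tight h (fun n => (2 : ℝ) ^ ((n : ℝ) / C - 2))
    (fun m => x (m + 1)) (fun m => hx _)
    (fun m y e => two_rpow_sub_le (div_sub_one_le hC (hs (m + 1))) (hy _ y e) (hy' _ y e)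
      m.succ_pos)
    (fun m y e => m.le_succ.trans (hy' _ y e))
  refine ⟨f, mem_exponential (D := D) hC h1 fun n => (h2 n).trans (max_le ?_ ?_), h3, h4⟩
  · refine Real.rpow_le_rpow_of_exponent_le one_le_two ?_
    have h5 := le_mul_succ_cast hD n
    have h6 : (n : ℝ) / C ≤ n :=
      div_le_self (Nat.cast_nonneg _) (by exact_mod_cast hC)
    linarith
  · rw [cast_two_pow]

/-- An upper bound `2 ^ O(n)` is tight as a root-exponential bound if there is a family of objects
of size `O(m ^ 2)` whose equivalent objects have size `2 ^ m - 1` at least. -/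
theorem ExpBounded.hasTightTranslation_root (h : ExpBounded X Y) {C : ℕ} (hC : 0 < C)
    (x : ℕ → X.Obj) (hx : ∀ m, UniformLength (X.lang (x m)))
    (hs : ∀ m, X.size (x m) ≤ (C * (m + 1)) ^ 2)
    (hy : ∀ m (y : Y.Obj), Y.lang y = X.lang (x m) → 2 ^ m ≤ Y.size y + 1) :
    HasTightTranslation RootExponential X Y := by
  obtain ⟨D, hD, h⟩ := h.exists_pos
  have hy' : ∀ m (y : Y.Obj), Y.lang y = X.lang (x m) → m ≤ Y.size y := fun m y e => by
    have h1 := hy m y e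
    have h2 := Nat.lt_two_pow_self (n := m)
    omega
  have hC' : (0 : ℝ) < C := by exact_mod_cast hC
  have hroot : ∀ m, √(X.size (x m) : ℝ) / C - 1 ≤ m := fun m => by
    have h' : (X.size (x m) : ℝ) ≤ (C * (m + 1)) ^ 2 := by exact_mod_cast hs m
    have h5 : √(X.size (x m) : ℝ) ≤ C * (m + 1) := Real.sqrt_le_iff.2 ⟨by positivity, h'⟩
    rw [sub_le_iff_le_add, div_le_iff₀ hC']
    linarith
  -- As in `ExpBounded.hasTightTranslation`, the member `x 0` is dropped.
  obtain ⟨f, h1, h2, h3, h4⟩ := exists_tight h (fun n => (2 : ℝ) ^ (√(n : ℝ) / C - 2))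
    (fun m => x (m + 1)) (fun m => hx _)
    (fun m y e => two_rpow_sub_le (hroot (m + 1)) (hy _ y e) (hy' _ y e) m.succ_pos)
    (fun m y e => m.le_succ.trans (hy' _ y e))
  refine ⟨f, mem_rootExponential (D := D) hC h1 fun n => (h2 n).trans (max_le ?_ ?_), h3, h4⟩
  · refine Real.rpow_le_rpow_of_exponent_le one_le_two ?_
    have h5 := le_mul_succ_cast hD n
    have h6 : √(n : ℝ) / C ≤ √n :=
      div_le_self (Real.sqrt_nonneg _) (by exact_mod_cast hC)
    have h7 : √(n : ℝ) ≤ n := by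
      refine Real.sqrt_le_iff.2 ⟨Nat.cast_nonneg _, ?_⟩
      have : n ≤ n ^ 2 := Nat.le_self_pow two_ne_zero n
      exact_mod_cast this
    linarith
  · rw [cast_two_pow]

/-- An upper bound `2 ^ 2 ^ O(n)` is tight if there is a family of objects of size `O(m)` whose
equivalent objects have size `2 ^ 2 ^ m - 1` at least. -/
theorem DoubleExpBounded.hasTightTranslation (h : DoubleExpBounded X Y) {C : ℕ} (hC : 0 < C)
    (x : ℕ → X.Obj) (hx : ∀ m, UniformLength (X.lang (x m)))
    (hs : ∀ m, X.size (x m) ≤ C * (m + 1))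
    (hy : ∀ m (y : Y.Obj), Y.lang y = X.lang (x m) → 2 ^ 2 ^ m ≤ Y.size y + 1) :
    HasTightTranslation DoubleExponential X Y := by
  obtain ⟨D, hD, h⟩ := h.exists_pos
  have hy' : ∀ m (y : Y.Obj), Y.lang y = X.lang (x m) → m ≤ Y.size y := fun m y e => by
    have h1 := hy m y e
    have h2 := Nat.lt_two_pow_self (n := m)
    have h3 := Nat.lt_two_pow_self (n := 2 ^ m)
    omega
  have hlo : ∀ m (y : Y.Obj), Y.lang y = X.lang (x m) →
      (2 : ℝ) ^ ((2 : ℝ) ^ ((X.size (x m) : ℝ) / C - 1) - 1) ≤ Y.size y := fun m y e => by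
    have h5 : (2 : ℝ) ^ ((X.size (x m) : ℝ) / C - 1) ≤ ((2 ^ m : ℕ) : ℝ) := by
      rw [cast_two_pow]
      exact Real.rpow_le_rpow_of_exponent_le one_le_two (div_sub_one_le hC (hs m))
    have h6 : (2 : ℝ) ^ ((2 : ℝ) ^ ((X.size (x m) : ℝ) / C - 1) - 1) ≤
        (2 : ℝ) ^ (((2 ^ m : ℕ) : ℝ) - 1) :=
      Real.rpow_le_rpow_of_exponent_le one_le_two (by linarith)
    have h7 : (2 : ℝ) ^ (((2 ^ m : ℕ) : ℝ) - 1) = 2 ^ 2 ^ m / 2 := by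
      rw [Real.rpow_sub two_pos, Real.rpow_one, Real.rpow_natCast]
    have h8 : (2 : ℝ) ^ 2 ^ m ≤ Y.size y + 1 := by exact_mod_cast hy m y e
    have h9 : (1 : ℝ) ≤ Y.size y := by
      have h10 : 2 ^ 1 ≤ 2 ^ 2 ^ m := Nat.pow_le_pow_right two_pos Nat.one_le_two_pow
      have h11 := hy m y e
      exact_mod_cast (by omega : 1 ≤ Y.size y)
    linarith
  obtain ⟨f, h1, h2, h3, h4⟩ := exists_tight h
    (fun n => (2 : ℝ) ^ ((2 : ℝ) ^ ((n : ℝ) / C - 1) - 1)) x hx hlo hy'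
  refine ⟨f, mem_doubleExponential (D := D) hC h1 fun n => (h2 n).trans (max_le ?_ ?_), h3, h4⟩
  · refine Real.rpow_le_rpow_of_exponent_le one_le_two ?_
    have h5 := le_mul_succ_cast hD n
    have h6 : (n : ℝ) / C ≤ n :=
      div_le_self (Nat.cast_nonneg _) (by exact_mod_cast hC)
    have h7 : (2 : ℝ) ^ ((n : ℝ) / C - 1) ≤ (2 : ℝ) ^ ((D * (n + 1) : ℕ) : ℝ) :=
      Real.rpow_le_rpow_of_exponent_le one_le_two (by linarith)
    linarith
  · rw [cast_two_pow_two_pow]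

end Bounds

/-! ### Composition of bounds -/

section Composition

variable {V : Type u} {X : Model.{u, v} V} {Y : Model.{u, v'} V} {Z : Model.{u, v''} V}

/-- A linear bound on the size of equivalent objects. -/
def LinearBounded (X : Model.{u, v} V) (Y : Model.{u, v'} V) : Prop :=
  ∃ C : ℕ, BoundedBy (fun n => C * (n + 1)) X Y

theorem BoundedBy.trans {U U' : ℕ → ℕ} (h : BoundedBy U X Y) (h' : BoundedBy U' Y Z)
    (hU' : Monotone U') : BoundedBy (fun n => U' (U n)) X Z := fun x hx => by
  obtain ⟨y, hy, hs⟩ := h x hx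
  obtain ⟨z, hz, hs'⟩ := h' y (hy ▸ hx)
  exact ⟨z, hz.trans hy, hs'.trans (hU' hs)⟩

theorem BoundedBy.precomp {U : ℕ → ℕ} (h : BoundedBy U Y Z) (e : X.Obj → Y.Obj)
    (hl : ∀ x, Y.lang (e x) = X.lang x) (hs : ∀ x, Y.size (e x) = X.size x) :
    BoundedBy U X Z := fun x hx => by
  obtain ⟨z, hz, hs'⟩ := h (e x) ((hl x).symm ▸ hx)
  exact ⟨z, hz.trans (hl x), hs x ▸ hs'⟩

theorem BoundedBy.postcomp {U : ℕ → ℕ} (h : BoundedBy U X Y) (e : Y.Obj → Z.Obj)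
    (hl : ∀ y, Z.lang (e y) = Y.lang y) (hs : ∀ y, Z.size (e y) = Y.size y) :
    BoundedBy U X Z := fun x hx => by
  obtain ⟨y, hy, hs'⟩ := h x hx
  exact ⟨e y, (hl y).trans hy, (hs y).symm ▸ hs'⟩

theorem add_two_pow_le (a b : ℕ) : a + 2 ^ b ≤ 2 ^ (a + b) := by
  have h1 : a + 1 ≤ 2 ^ a := Nat.lt_two_pow_self
  have h2 : 1 ≤ 2 ^ b := Nat.one_le_two_pow
  rw [pow_add]
  nlinarith

theorem mul_two_pow_add_one_le (a b : ℕ) : a * (2 ^ b + 1) ≤ 2 ^ (a + 1 + b) := by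
  have h1 : a ≤ 2 ^ a := Nat.lt_two_pow_self.le
  have h2 : 2 ^ b + 1 ≤ 2 ^ (1 + b) := by
    rw [pow_add]
    have : 1 ≤ 2 ^ b := Nat.one_le_two_pow
    omega
  rw [add_assoc, pow_add]
  exact Nat.mul_le_mul h1 h2

theorem ExpBounded.trans_linear (h : ExpBounded X Y) (h' : LinearBounded Y Z) :
    ExpBounded X Z := by
  obtain ⟨C, h⟩ := h
  obtain ⟨D, h'⟩ := h'
  refine ⟨D + 1 + C, (h.trans h' fun a b hab => by gcongr).mono fun n => ?_⟩
  refine (mul_two_pow_add_one_le _ _).trans (Nat.pow_le_pow_right two_pos ?_)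
  nlinarith

theorem DoubleExpBounded.trans_linear (h : DoubleExpBounded X Y) (h' : LinearBounded Y Z) :
    DoubleExpBounded X Z := by
  obtain ⟨C, h⟩ := h
  obtain ⟨D, h'⟩ := h'
  refine ⟨D + 1 + C, (h.trans h' fun a b hab => by gcongr).mono fun n => ?_⟩
  refine (mul_two_pow_add_one_le _ _).trans (Nat.pow_le_pow_right two_pos ?_)
  refine (add_two_pow_le _ _).trans (Nat.pow_le_pow_right two_pos ?_)
  nlinarith

theorem ExpBounded.trans_exp (h : ExpBounded X Y) (h' : ExpBounded Y Z) :
    DoubleExpBounded X Z := by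
  obtain ⟨C, h⟩ := h
  obtain ⟨D, h'⟩ := h'
  refine ⟨D + 1 + C, (h.trans h' fun a b hab => ?_).mono fun n => ?_⟩
  · exact Nat.pow_le_pow_right two_pos (by gcongr)
  · refine Nat.pow_le_pow_right two_pos ?_
    refine (mul_two_pow_add_one_le _ _).trans (Nat.pow_le_pow_right two_pos ?_)
    nlinarith

end Composition

/-! ### Runs of finite automata -/

section Automata

variable {V : Type u} {Q : Type w} {M : NFA V Q}

theorem mem_acceptsFrom_singleton_nil {q : Q} : [] ∈ M.acceptsFrom {q} ↔ q ∈ M.accept := by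
  simp

theorem mem_acceptsFrom_iff_exists {S : Set Q} {x : List V} :
    x ∈ M.acceptsFrom S ↔ ∃ q ∈ S, x ∈ M.acceptsFrom {q} := by
  simp only [NFA.mem_acceptsFrom]
  constructor
  · rintro ⟨t, ht, h⟩
    obtain ⟨q, hq, h⟩ := NFA.mem_evalFrom_iff_exists.1 h
    exact ⟨q, hq, t, ht, h⟩
  · rintro ⟨q, hq, t, ht, h⟩
    exact ⟨t, ht, NFA.mem_evalFrom_iff_exists.2 ⟨q, hq, h⟩⟩

theorem mem_acceptsFrom_singleton_cons {q : Q} {a : V} {x : List V} :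
    a :: x ∈ M.acceptsFrom {q} ↔ ∃ q' ∈ M.step q a, x ∈ M.acceptsFrom {q'} := by
  rw [NFA.cons_mem_acceptsFrom, NFA.stepSet_singleton, mem_acceptsFrom_iff_exists]

theorem mem_accepts_iff_exists {x : List V} :
    x ∈ M.accepts ↔ ∃ q ∈ M.start, x ∈ M.acceptsFrom {q} := by
  rw [NFA.accepts_eq_acceptsFrom_start, mem_acceptsFrom_iff_exists]

/-- A local criterion for unambiguity: two different initial states, and two different successors
of a state under the same symbol, never accept the same word. The second condition is only required
for states in some set `Inv` that contains the initial states and is closed under transitions. -/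
def RunUnique (M : NFA V Q) : Prop :=
  ∃ Inv : Q → Prop, (∀ s ∈ M.start, Inv s) ∧
    (∀ q a, Inv q → ∀ q' ∈ M.step q a, Inv q') ∧
    (∀ x, ∀ s ∈ M.start, ∀ s' ∈ M.start,
      x ∈ M.acceptsFrom {s} → x ∈ M.acceptsFrom {s'} → s = s') ∧
    ∀ q a x, Inv q → ∀ q₁ ∈ M.step q a, ∀ q₂ ∈ M.step q a,
      x ∈ M.acceptsFrom {q₁} → x ∈ M.acceptsFrom {q₂} → q₁ = q₂

theorem mem_acceptsFrom_of_path {q t : Q} {x : List V} (p : M.Path q t x) (ht : t ∈ M.accept) :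
    x ∈ M.acceptsFrom {q} :=
  ⟨t, ht, NFA.mem_evalFrom_iff_nonempty_path.2 ⟨p⟩⟩

/-- Two accepting runs on the same word from a state in `Inv` agree. -/
theorem path_unique {Inv : Q → Prop} (hstep : ∀ q a, Inv q → ∀ q' ∈ M.step q a, Inv q')
    (huniq : ∀ q a x, Inv q → ∀ q₁ ∈ M.step q a, ∀ q₂ ∈ M.step q a,
      x ∈ M.acceptsFrom {q₁} → x ∈ M.acceptsFrom {q₂} → q₁ = q₂)
    {q t : Q} {x : List V} (p : M.Path q t x) (hq : Inv q) (ht : t ∈ M.accept) :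
    ∀ (t' : Q) (p' : M.Path q t' x), t' ∈ M.accept →
      (⟨t, p⟩ : Σ t, M.Path q t x) = ⟨t', p'⟩ := by
  induction p with
  | nil s =>
    intro t' p' _
    cases p'
    rfl
  | cons r s u a x hr p ih =>
    intro t' p' ht'
    cases p' with
    | cons r' _ _ _ _ hr' p' =>
      obtain rfl : r = r' := huniq s a x hq _ hr _ hr' (mem_acceptsFrom_of_path p ht)
        (mem_acceptsFrom_of_path p' ht')
      have h := ih (hstep _ _ hq _ hr) ht _ p' ht'
      cases h
      rfl

theorem RunUnique.subsingleton (h : RunUnique M) (x : List V) :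
    Subsingleton (Σ (s : M.start) (t : M.accept), M.Path s t x) := by
  obtain ⟨Inv, hs, hstep, hstart, huniq⟩ := h
  refine ⟨?_⟩
  rintro ⟨⟨s, hs₁⟩, ⟨t, ht⟩, p⟩ ⟨⟨s', hs₂⟩, ⟨t', ht'⟩, p'⟩
  obtain rfl : s = s' := hstart x _ hs₁ _ hs₂ (mem_acceptsFrom_of_path p ht)
    (mem_acceptsFrom_of_path p' ht')
  have h := path_unique hstep huniq p (hs _ hs₁) ht t' p' ht'
  cases h
  rfl

theorem FinAutomaton.Deterministic.unambiguous {A : FinAutomaton V} (h : A.Deterministic) :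
    A.Unambiguous := fun x => by
  refine RunUnique.subsingleton ⟨fun _ => True, fun _ _ => trivial, fun _ _ _ _ _ => trivial, ?_,
    fun q a x _ q₁ h₁ q₂ h₂ _ _ => h.2 q a h₁ h₂⟩ x
  intro x s hs s' hs' _ _
  obtain ⟨q, hq⟩ := h.1
  rw [hq] at hs hs'
  exact hs.trans hs'.symm

/-- Finite automata may be constructed on any finite type of states. -/
theorem exists_finAutomaton [Finite Q] (M : NFA V Q)
    (hfin : {t : Q × V × Q | t.2.2 ∈ M.step t.1 t.2.1}.Finite) :
    ∃ A : FinAutomaton V, A.nfa.accepts = M.accepts ∧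
      A.size = Nat.card Q + {t : Q × V × Q | t.2.2 ∈ M.step t.1 t.2.1}.ncard ∧
      (RunUnique M → A.Unambiguous) ∧
      ((∃ s, M.start = {s}) → (∀ q a, (M.step q a).Subsingleton) → A.Deterministic) := by
  obtain ⟨n, ⟨e⟩⟩ := Finite.exists_equiv_fin Q
  set M' : NFA V (Fin n) :=
    { step := fun q a => e.symm ⁻¹' M.step (e.symm q) a
      start := e.symm ⁻¹' M.start
      accept := e.symm ⁻¹' M.accept } with hM'
  set E : Fin n × V × Fin n ≃ Q × V × Q :=
    Equiv.prodCongr e.symm (Equiv.prodCongr (Equiv.refl V) e.symm) with hE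
  have hT : {t : Fin n × V × Fin n | t.2.2 ∈ M'.step t.1 t.2.1} =
      E ⁻¹' {t : Q × V × Q | t.2.2 ∈ M.step t.1 t.2.1} := rfl
  have hacc : ∀ (x : List V) (q : Fin n),
      x ∈ M'.acceptsFrom {q} ↔ x ∈ M.acceptsFrom {e.symm q} := by
    intro x
    induction x with
    | nil =>
      intro q
      rw [mem_acceptsFrom_singleton_nil, mem_acceptsFrom_singleton_nil]
      rfl
    | cons a x ih =>
      intro q
      rw [mem_acceptsFrom_singleton_cons, mem_acceptsFrom_singleton_cons]
      constructor
      · rintro ⟨q', h, hx⟩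
        exact ⟨e.symm q', h, (ih q').1 hx⟩
      · rintro ⟨q', h, hx⟩
        refine ⟨e q', ?_, (ih _).2 ?_⟩
        · simpa [hM'] using h
        · simpa using hx
  refine ⟨⟨Fin n, inferInstance, M', hT ▸ hfin.preimage E.injective.injOn⟩, ?_, ?_, ?_, ?_⟩
  · ext x
    rw [mem_accepts_iff_exists, mem_accepts_iff_exists]
    constructor
    · rintro ⟨q, h, hx⟩
      exact ⟨e.symm q, h, (hacc x q).1 hx⟩
    · rintro ⟨q, h, hx⟩
      exact ⟨e q, by simpa [hM'] using h, (hacc x _).2 (by simpa using hx)⟩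
  · change Nat.card (Fin n) + {t : Fin n × V × Fin n | t.2.2 ∈ M'.step t.1 t.2.1}.ncard = _
    rw [hT, Nat.card_congr e, Set.ncard_preimage_of_injective_subset_range E.injective]
    rw [E.surjective.range_eq]
    exact Set.subset_univ _
  · rintro ⟨Inv, h1, h2, h3, h4⟩ x
    refine RunUnique.subsingleton (M := M') ⟨fun q => Inv (e.symm q), fun s hs => h1 _ hs,
      fun q a hq q' hq' => h2 _ a hq _ hq', ?_, ?_⟩ x
    · intro x s hs s' hs' hx hx'
      exact e.symm.injective (h3 x _ hs _ hs' ((hacc x s).1 hx) ((hacc x s').1 hx'))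
    · intro q a x hq q₁ hq₁ q₂ hq₂ hx₁ hx₂
      exact e.symm.injective (h4 _ a x hq _ hq₁ _ hq₂ ((hacc x _).1 hx₁) ((hacc x _).1 hx₂))
  · rintro ⟨s, hs⟩ hdet
    refine ⟨⟨e s, ?_⟩, fun q a q₁ h₁ q₂ h₂ => e.symm.injective (hdet _ _ h₁ h₂)⟩
    ext q
    change e.symm q ∈ M.start ↔ q = e s
    rw [hs, Set.mem_singleton_iff, Equiv.symm_apply_eq]

/-- `IsRun M q τ q'`: the list `τ` of transitions is a run of `M` from `q` to `q'`. -/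
def IsRun (M : NFA V Q) : Q → List (Q × V × Q) → Q → Prop
  | q, [], q' => q = q'
  | q, t :: τ, q' => t.1 = q ∧ t.2.2 ∈ M.step t.1 t.2.1 ∧ IsRun M t.2.2 τ q'

/-- The word read by a list of transitions. -/
def runWord (τ : List (Q × V × Q)) : List V := τ.map fun t => t.2.1

theorem mem_acceptsFrom_iff_exists_isRun {x : List V} {q : Q} :
    x ∈ M.acceptsFrom {q} ↔ ∃ τ, ∃ q' ∈ M.accept, IsRun M q τ q' ∧ runWord τ = x := by
  induction x generalizing q with
  | nil =>
    rw [mem_acceptsFrom_singleton_nil]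
    constructor
    · intro h
      exact ⟨[], q, h, rfl, rfl⟩
    · rintro ⟨τ, q', h, hr, hw⟩
      obtain rfl : τ = [] := List.map_eq_nil_iff.1 hw
      rwa [show q = q' from hr]
  | cons a x ih =>
    rw [mem_acceptsFrom_singleton_cons]
    constructor
    · rintro ⟨q', hq', hx⟩
      obtain ⟨τ, q'', h, hr, rfl⟩ := ih.1 hx
      exact ⟨(q, a, q') :: τ, q'', h, ⟨rfl, hq', hr⟩, rfl⟩
    · rintro ⟨τ, q'', h, hr, hw⟩
      cases τ with
      | nil => cases hw
      | cons t τ =>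
        obtain ⟨rfl, ht, hr⟩ := hr
        obtain ⟨rfl, rfl⟩ := List.cons_eq_cons.1 hw
        exact ⟨_, ht, ih.2 ⟨τ, q'', h, hr, rfl⟩⟩

theorem isRun_append {τ τ' : List (Q × V × Q)} {q q'' : Q} :
    IsRun M q (τ ++ τ') q'' ↔ ∃ q', IsRun M q τ q' ∧ IsRun M q' τ' q'' := by
  induction τ generalizing q with
  | nil => simp [IsRun]
  | cons t τ ih =>
    simp only [List.cons_append, IsRun, ih]
    tauto

theorem IsRun.mem {τ : List (Q × V × Q)} {q q' : Q} (h : IsRun M q τ q') {t : Q × V × Q}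
    (ht : t ∈ τ) : t.2.2 ∈ M.step t.1 t.2.1 := by
  induction τ generalizing q with
  | nil => simp at ht
  | cons s τ ih =>
    rcases List.mem_cons.1 ht with rfl | ht
    · exact h.2.1
    · exact ih h.2.2 ht

theorem mem_accepts_of_isRun {τ : List (Q × V × Q)} {q q' : Q} (hq : q ∈ M.start)
    (h : IsRun M q τ q') (hq' : q' ∈ M.accept) : runWord τ ∈ M.accepts :=
  mem_accepts_iff_exists.2 ⟨q, hq, mem_acceptsFrom_iff_exists_isRun.2 ⟨τ, q', hq', h, rfl⟩⟩

/-- In an automaton with a uniform-length language, a transition occurs at only one position of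
accepting runs: otherwise a beginning of one run and an end of another one could be combined to an
accepting run of the wrong length. -/
theorem index_unique {k : ℕ} (hk : ∀ x ∈ M.accepts, x.length = k)
    {τ τ' : List (Q × V × Q)} {q q' s s' : Q} (hq : q ∈ M.start)
    (h : IsRun M q τ q') (hs : s ∈ M.start) (hs' : s' ∈ M.accept) (h' : IsRun M s τ' s')
    {i j : ℕ} (hi : i < τ.length) (hj : j < τ'.length) (hij : τ[i] = τ'[j]) : i = j := by
  have e1 : τ.take i ++ τ.drop i = τ := List.take_append_drop i τ
  have e2 : τ'.take j ++ τ'.drop j = τ' := List.take_append_drop j τ'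
  have h1 := h
  have h2 := h'
  rw [← e1, isRun_append] at h1
  rw [← e2, isRun_append] at h2
  obtain ⟨p, hp, hp'⟩ := h1
  obtain ⟨r, hr, hr'⟩ := h2
  have hpr : p = r := by
    rw [List.drop_eq_getElem_cons hi] at hp'
    rw [List.drop_eq_getElem_cons hj] at hr'
    rw [← hp'.1, ← hr'.1, hij]
  subst hpr
  have h3 := hk _ (mem_accepts_of_isRun hq (isRun_append.2 ⟨p, hp, hr'⟩) hs')
  have h4 := hk _ (mem_accepts_of_isRun hs h' hs')
  simp only [runWord, List.length_map, List.length_append, List.length_take,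
    List.length_drop] at h3 h4
  omega

/-- An accepting run is determined by the set of its transitions. -/
theorem accepting_run_eq {k : ℕ} (hk : ∀ x ∈ M.accepts, x.length = k)
    {τ τ' : List (Q × V × Q)} {q q' s s' : Q} (hq : q ∈ M.start) (hq' : q' ∈ M.accept)
    (h : IsRun M q τ q') (hs : s ∈ M.start) (hs' : s' ∈ M.accept) (h' : IsRun M s τ' s')
    (hsub : ∀ t ∈ τ, t ∈ τ') : τ = τ' := by
  have h3 := hk _ (mem_accepts_of_isRun hq h hq')
  have h4 := hk _ (mem_accepts_of_isRun hs h' hs')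
  simp only [runWord, List.length_map] at h3 h4
  refine List.ext_getElem (h3.trans h4.symm) fun i hi hi' => ?_
  obtain ⟨j, hj, hij⟩ := List.getElem_of_mem (hsub _ (List.getElem_mem hi))
  obtain rfl := index_unique hk hq h hs hs' h' hi hj hij.symm
  exact hij.symm

theorem exists_accepting_run {x : List V} (hx : x ∈ M.accepts) :
    ∃ τ, ∃ q ∈ M.start, ∃ q' ∈ M.accept, IsRun M q τ q' ∧ runWord τ = x := by
  obtain ⟨q, hq, h⟩ := mem_accepts_iff_exists.1 hx
  obtain ⟨τ, q', hq', h, hw⟩ := mem_acceptsFrom_iff_exists_isRun.1 h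
  exact ⟨τ, q, hq, q', hq', h, hw⟩

/-- The transitions of an accepting run are distinct, so a word is not longer than the number of
transitions. -/
theorem FinAutomaton.length_le_size (A : FinAutomaton V) (hA : UniformLength A.nfa.accepts)
    {x : List V} (hx : x ∈ A.nfa.accepts) : x.length ≤ A.size := by
  classical
  obtain ⟨k, hk⟩ := hA
  obtain ⟨τ, q, hq, q', hq', h, rfl⟩ := exists_accepting_run hx
  have hnd : τ.Nodup := by
    rw [List.nodup_iff_injective_get]
    rintro ⟨i, hi⟩ ⟨j, hj⟩ hij
    exact Fin.ext (index_unique hk hq h hq hq' h hi hj hij)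
  have h1 : (τ.toFinset : Set (A.State × V × A.State)) ⊆
      {t | t.2.2 ∈ A.nfa.step t.1 t.2.1} := fun t ht => h.mem (by simpa using ht)
  have h2 := Set.ncard_le_ncard h1 A.finite_transitions
  rw [Set.ncard_coe_finset, List.toFinset_card_of_nodup hnd] at h2
  rw [runWord, List.length_map]
  exact h2.trans (Nat.le_add_left _ _)

/-- There are at most as many words as sets of transitions. -/
theorem FinAutomaton.finite_and_ncard_le (A : FinAutomaton V)
    (hA : UniformLength A.nfa.accepts) :
    (A.nfa.accepts : Set (List V)).Finite ∧
      (A.nfa.accepts : Set (List V)).ncard ≤ 2 ^ A.size := by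
  classical
  obtain ⟨k, hk⟩ := hA
  have hrun : ∀ x : List V, ∃ τ, x ∈ A.nfa.accepts → ∃ q ∈ A.nfa.start, ∃ q' ∈ A.nfa.accept,
      IsRun A.nfa q τ q' ∧ runWord τ = x := fun x => by
    by_cases hx : x ∈ A.nfa.accepts
    · obtain ⟨τ, hτ⟩ := exists_accepting_run hx
      exact ⟨τ, fun _ => hτ⟩
    · exact ⟨[], fun h => (hx h).elim⟩
  choose ρ hρ using hrun
  set T := A.finite_transitions.toFinset with hT
  have hmaps : ∀ x ∈ (A.nfa.accepts : Set (List V)),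
      (ρ x).toFinset ∈ (T.powerset : Set (Finset (A.State × V × A.State))) := by
    intro x hx
    obtain ⟨q, hq, q', hq', h, -⟩ := hρ x hx
    rw [Finset.mem_coe, Finset.mem_powerset]
    intro t ht
    rw [hT, Set.Finite.mem_toFinset]
    exact h.mem (List.mem_toFinset.1 ht)
  have hinj : Set.InjOn (fun x => (ρ x).toFinset) (A.nfa.accepts : Set (List V)) := by
    intro x hx y hy hxy
    obtain ⟨q, hq, q', hq', h, e⟩ := hρ x hx
    obtain ⟨s, hs, s', hs', h', e'⟩ := hρ y hy
    rw [← e, ← e', accepting_run_eq hk hq hq' h hs hs' h' fun t ht => by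
      rw [← List.mem_toFinset] at ht ⊢
      exact (Finset.ext_iff.1 hxy t).1 ht]
  have hfin : (T.powerset : Set (Finset (A.State × V × A.State))).Finite := Finset.finite_toSet _
  refine ⟨Set.Finite.of_injOn hmaps hinj hfin, ?_⟩
  refine (Set.ncard_le_ncard_of_injOn _ hmaps hinj hfin).trans ?_
  rw [Set.ncard_coe_finset, Finset.card_powerset]
  refine Nat.pow_le_pow_right two_pos ?_
  rw [hT, ← Set.ncard_eq_toFinset_card _ A.finite_transitions]
  exact Nat.le_add_left _ _

end Automata

/-! ### Translations between automata, word sets and grammars -/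

section Translations

variable {V : Type u}

theorem expBounded_NFAs_WordSets : ExpBounded (NFAs V) (WordSets V) := by
  refine ⟨2, fun (A : FinAutomaton V) hA => ?_⟩
  obtain ⟨hfin, hcard⟩ := A.finite_and_ncard_le hA
  refine ⟨hfin.toFinset, Set.ext fun x => hfin.mem_toFinset, ?_⟩
  change ∑ x ∈ hfin.toFinset, (x.length + 1) ≤ 2 ^ (2 * (A.size + 1))
  have h1 : ∑ x ∈ hfin.toFinset, (x.length + 1) ≤ hfin.toFinset.card * (A.size + 1) := by
    refine Finset.sum_le_card_nsmul _ _ _ fun x hx => ?_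
    have := A.length_le_size hA (hfin.mem_toFinset.1 hx)
    omega
  rw [← Set.ncard_eq_toFinset_card _ hfin] at h1
  refine h1.trans ((Nat.mul_le_mul hcard Nat.lt_two_pow_self).trans ?_)
  rw [← pow_add]
  exact Nat.pow_le_pow_right two_pos (by omega)

theorem expBounded_UFAs_WordSets : ExpBounded (UFAs V) (WordSets V) :=
  let ⟨C, h⟩ := expBounded_NFAs_WordSets
  ⟨C, h.precomp (X := UFAs V) (fun A => A.1) (fun _ => rfl) fun _ => rfl⟩

theorem expBounded_DFAs_WordSets : ExpBounded (DFAs V) (WordSets V) :=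
  let ⟨C, h⟩ := expBounded_NFAs_WordSets
  ⟨C, h.precomp (X := DFAs V) (fun A => A.1) (fun _ => rfl) fun _ => rfl⟩

/-- The prefixes of the words in `S`, together with the empty word. -/
def triePrefixes (S : Finset (List V)) : Set (List V) :=
  {p | p = [] ∨ ∃ x ∈ S, p <+: x}

theorem finite_triePrefixes_and_ncard_le (S : Finset (List V)) :
    (triePrefixes S).Finite ∧
      (triePrefixes S).ncard ≤ (∑ x ∈ S, (x.length + 1)) + 1 := by
  classical
  have h : triePrefixes S ⊆ (insert [] (S.biUnion fun x => x.inits.toFinset) : Finset _) := by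
    rintro p (rfl | ⟨x, hx, hp⟩)
    · simp
    · rw [Finset.mem_coe, Finset.mem_insert, Finset.mem_biUnion]
      exact Or.inr ⟨x, hx, by simpa using hp⟩
  refine ⟨(Finset.finite_toSet _).subset h, (Set.ncard_le_ncard h (Finset.finite_toSet _)).trans ?_⟩
  rw [Set.ncard_coe_finset]
  refine (Finset.card_insert_le _ _).trans (Nat.add_le_add_right ?_ 1)
  refine Finset.card_biUnion_le.trans (Finset.sum_le_sum fun x _ => ?_)
  exact (List.toFinset_card_le _).trans (by simp)

/-- The trie of a finite set of words. -/
def trie (S : Finset (List V)) : NFA V (triePrefixes S) where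
  step p a := {p' | p'.1 = p.1 ++ [a]}
  start := {⟨[], Or.inl rfl⟩}
  accept := {p | p.1 ∈ S}

theorem mem_trie_acceptsFrom {S : Finset (List V)} {x : List V} {p : triePrefixes S} :
    x ∈ (trie S).acceptsFrom {p} ↔ p.1 ++ x ∈ S := by
  induction x generalizing p with
  | nil =>
    rw [mem_acceptsFrom_singleton_nil, List.append_nil]
    rfl
  | cons a x ih =>
    rw [mem_acceptsFrom_singleton_cons, List.append_cons]
    constructor
    · rintro ⟨q, hq, hx⟩
      have hq : q.1 = p.1 ++ [a] := hq
      rw [← hq]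
      exact ih.1 hx
    · intro hx
      exact ⟨⟨p.1 ++ [a], Or.inr ⟨_, hx, List.prefix_append _ _⟩⟩, rfl, ih.2 hx⟩

theorem linearBounded_WordSets_DFAs : LinearBounded (WordSets V) (DFAs V) := by
  refine ⟨2, fun (S : Finset (List V)) _ => ?_⟩
  obtain ⟨hfin, hcard⟩ := finite_triePrefixes_and_ncard_le S
  have : Finite (triePrefixes S) := hfin
  -- A transition of the trie is determined by its target.
  set T := {t : triePrefixes S × V × triePrefixes S | t.2.2 ∈ (trie S).step t.1 t.2.1} with hT
  have hinj : Set.InjOn (fun t : triePrefixes S × V × triePrefixes S => t.2.2) T := by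
    rintro ⟨p, a, q⟩ h ⟨p', a', q'⟩ h' (rfl : q = q')
    have h : q.1 = p.1 ++ [a] := h
    have h' : q.1 = p'.1 ++ [a'] := h'
    obtain ⟨h1, h2⟩ := List.append_inj' (h.symm.trans h') rfl
    obtain rfl : p = p' := Subtype.ext h1
    obtain rfl : a = a' := List.singleton_inj.1 h2
    rfl
  have hTfin : T.Finite :=
    Set.Finite.of_injOn (t := Set.univ) (fun _ _ => Set.mem_univ _) hinj Set.finite_univ
  have hTcard : T.ncard ≤ Nat.card (triePrefixes S) := by
    rw [← Set.ncard_univ]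
    exact Set.ncard_le_ncard_of_injOn _ (fun _ _ => Set.mem_univ _) hinj
  obtain ⟨A, hA, hs, -, hdet⟩ := exists_finAutomaton (trie S) hTfin
  refine ⟨⟨A, hdet ⟨_, rfl⟩ ?_⟩, ?_, ?_⟩
  · exact fun q a q₁ h₁ q₂ h₂ => Subtype.ext (Eq.trans h₁ (Eq.symm h₂))
  · refine hA.trans (Set.ext fun x => ?_)
    refine mem_accepts_iff_exists.trans ?_
    constructor
    · rintro ⟨q, rfl, hx⟩
      exact mem_trie_acceptsFrom.1 hx
    · intro hx
      exact ⟨_, rfl, mem_trie_acceptsFrom.2 hx⟩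
  · change A.size ≤ 2 * ((∑ x ∈ S, (x.length + 1)) + 1)
    have hs : A.size = (triePrefixes S).ncard + T.ncard := hs
    have hTcard : T.ncard ≤ (triePrefixes S).ncard := hTcard
    omega

theorem linearBounded_WordSets_UFAs : LinearBounded (WordSets V) (UFAs V) :=
  let ⟨C, h⟩ := linearBounded_WordSets_DFAs
  ⟨C, h.postcomp (Z := UFAs V) (fun A => ⟨A.1, A.2.unambiguous⟩) (fun _ => rfl) fun _ => rfl⟩

open Classical in
/-- One rule for each word of a finite set, with a single nonterminal. -/
noncomputable def listRules (S : Finset (List V)) : Finset (ContextFreeRule V Unit) :=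
  S.image fun x => ⟨(), x.map Symbol.terminal⟩

/-- The grammar with one rule for each word of a finite set. -/
noncomputable abbrev listGrammar (S : Finset (List V)) : ContextFreeGrammar.{u} V where
  NT := Unit
  initial := ()
  rules := listRules S

theorem mem_listRules {S : Finset (List V)} {r : ContextFreeRule V Unit} :
    r ∈ listRules S ↔ ∃ x ∈ S, (⟨(), x.map Symbol.terminal⟩ : ContextFreeRule V Unit) = r := by
  classical
  exact Finset.mem_image

theorem mem_listGrammar_formLanguage {S : Finset (List V)} {x : List V} {A : Unit} :
    x ∈ formLanguage (listGrammar S) [Symbol.nonterminal A] ↔ x ∈ S := by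
  rw [mem_formLanguage_nonterminal]
  constructor
  · rintro ⟨r, hr, -, hx⟩
    obtain ⟨y, hy, rfl⟩ := mem_listRules.1 hr
    have : x ∈ formLanguage (listGrammar S) (y.map Symbol.terminal) := hx
    rw [formLanguage_map_terminal] at this
    obtain rfl : x = y := this
    exact hy
  · intro hx
    refine ⟨_, mem_listRules.2 ⟨x, hx, rfl⟩, rfl, ?_⟩
    change x ∈ formLanguage (listGrammar S) (x.map Symbol.terminal)
    rw [formLanguage_map_terminal]
    rfl

theorem grammarSize_le (g : ContextFreeGrammar.{u} V) :
    grammarSize g ≤ ∑ r ∈ g.rules, concatSize r.output + g.rules.card :=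
  Nat.add_le_add_left (Nat.sub_le _ _) _

theorem concatSize_le {S : Type u} (α : List S) : concatSize α ≤ 2 * α.length + 1 := by
  unfold concatSize
  split_ifs <;> omega

theorem linearBounded_WordSets_UCFGs : LinearBounded (WordSets V) (UCFGs V) := by
  refine ⟨3, fun (S : Finset (List V)) hS => ?_⟩
  refine ⟨⟨listGrammar S, fun t t' h => ?_⟩, ?_, ?_⟩
  · obtain ⟨k, hk⟩ := hS
    refine Forest.eq_of_yield_eq (fun A => ⟨k, fun x hx => ?_⟩) ?_ t t' h
    · exact hk x (mem_listGrammar_formLanguage.1 hx)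
    · intro r hr r' hr' _ x hx hx'
      obtain ⟨y, hy, rfl⟩ := mem_listRules.1 hr
      obtain ⟨y', hy', rfl⟩ := mem_listRules.1 hr'
      change x ∈ formLanguage (listGrammar S) (y.map Symbol.terminal) at hx
      change x ∈ formLanguage (listGrammar S) (y'.map Symbol.terminal) at hx'
      rw [formLanguage_map_terminal] at hx hx'
      obtain rfl : x = y := hx
      obtain rfl : x = y' := hx'
      rfl
  · refine (language_eq_formLanguage _).trans (Set.ext fun x => ?_)
    exact mem_listGrammar_formLanguage
  · classical
    change grammarSize (listGrammar S) ≤ 3 * ((∑ x ∈ S, (x.length + 1)) + 1)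
    have h1 : ∑ r ∈ listRules S, concatSize r.output ≤ ∑ x ∈ S, (2 * x.length + 1) := by
      rw [listRules, Finset.sum_image]
      · refine Finset.sum_le_sum fun x _ => (concatSize_le _).trans ?_
        rw [List.length_map]
      · intro x _ y _ hxy
        have : x.map (Symbol.terminal (N := Unit)) = y.map Symbol.terminal := by
          simpa using congrArg ContextFreeRule.output hxy
        exact List.map_injective_iff.2 (fun a b h => by simpa using h) this
    have h2 : (listRules S).card ≤ S.card := Finset.card_image_le
    have h3 : S.card = ∑ x ∈ S, 1 := by simp
    have h4 : ∑ x ∈ S, (2 * x.length + 1) + ∑ x ∈ S, 1 ≤ 3 * ∑ x ∈ S, (x.length + 1) := by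
      rw [← Finset.sum_add_distrib, Finset.mul_sum]
      exact Finset.sum_le_sum fun x _ => by omega
    refine (grammarSize_le _).trans ?_
    change ∑ r ∈ listRules S, concatSize r.output + (listRules S).card ≤ _
    omega

end Translations

/-! ### Automata for grammars: leftmost derivations with bounded stacks -/

section StackAutomaton

variable {V : Type u} {g : ContextFreeGrammar.{u} V}

/-- The first terminal of a forest together with the forest to the right of it; the trees to the
left of it, which have empty yield, are dropped. -/
def Forest.next : {l : List (Symbol V g.NT)} → Forest g l →
    Option (V × Σ l' : List (Symbol V g.NT), Forest g l')
  | _, .nil => none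
  | _, .terminal a rest => some (a, ⟨_, rest⟩)
  | _, .nonterminal _ _ ch rest =>
    match ch.next with
    | none => rest.next
    | some (a, ⟨_, ch'⟩) => some (a, ⟨_, ch'.append rest⟩)

/-- The sentential forms that remain to the right of the successive terminals of a forest. -/
def Forest.pending : {l : List (Symbol V g.NT)} → Forest g l → List (List (Symbol V g.NT))
  | _, .nil => []
  | _, .terminal (l := l) _ rest => l :: rest.pending
  | _, .nonterminal (l := l) _ _ ch rest => ch.pending.map (· ++ l) ++ rest.pending

theorem Forest.of_next_eq_none {l : List (Symbol V g.NT)} {t : Forest g l}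
    (h : t.next = none) : t.yield = [] ∧ t.pending = [] := by
  induction t with
  | nil => exact ⟨rfl, rfl⟩
  | terminal a rest _ => simp [next] at h
  | nonterminal r hr ch rest ihc ihr =>
    rcases hc : ch.next with _ | ⟨a, l', ch'⟩
    · simp only [next, hc] at h
      obtain ⟨h1, h2⟩ := ihc hc
      obtain ⟨h3, h4⟩ := ihr h
      rw [yield, pending, h1, h2, h3, h4]
      exact ⟨rfl, rfl⟩
    · simp [next, hc] at h

theorem Forest.pending_append {l l' : List (Symbol V g.NT)} (t : Forest g l) (t' : Forest g l') :
    (t.append t').pending = t.pending.map (· ++ l') ++ t'.pending := by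
  induction t with
  | nil => rfl
  | terminal a rest ih => simp [append, pending, ih]
  | nonterminal r hr ch rest _ ih => simp [append, pending, ih, Function.comp_def]

theorem Forest.of_next_eq_some {l l' : List (Symbol V g.NT)} {t : Forest g l} {a : V}
    {t' : Forest g l'} (h : t.next = some (a, ⟨l', t'⟩)) :
    t.yield = a :: t'.yield ∧ t.pending = l' :: t'.pending := by
  induction t generalizing l' with
  | nil => simp [next] at h
  | terminal b rest _ =>
    simp only [next, Option.some.injEq, Prod.mk.injEq] at h
    obtain ⟨rfl, h⟩ := h
    cases h
    exact ⟨rfl, rfl⟩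
  | nonterminal r hr ch rest ihc ihr =>
    rcases hc : ch.next with _ | ⟨b, l₁, ch'⟩
    · simp only [next, hc] at h
      obtain ⟨hy, hs⟩ := of_next_eq_none hc
      obtain ⟨h1, h2⟩ := ihr h
      rw [yield, pending, hy, hs, h1, h2]
      exact ⟨rfl, rfl⟩
    · simp only [next, hc, Option.some.injEq, Prod.mk.injEq] at h
      obtain ⟨rfl, h⟩ := h
      cases h
      obtain ⟨h1, h2⟩ := ihc hc
      rw [yield, pending, yield_append, pending_append, h1, h2]
      exact ⟨rfl, by simp⟩

/-- What remains to the right of the first terminal of a forest can be replaced. -/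
theorem Forest.exists_next_eq {l l' : List (Symbol V g.NT)} {t : Forest g l} {a : V}
    {t' : Forest g l'} (h : t.next = some (a, ⟨l', t'⟩)) (t'' : Forest g l') :
    ∃ s : Forest g l, s.next = some (a, ⟨l', t''⟩) := by
  induction t generalizing l' with
  | nil => simp [next] at h
  | terminal b rest _ =>
    simp only [next, Option.some.injEq, Prod.mk.injEq] at h
    obtain ⟨rfl, h⟩ := h
    cases h
    exact ⟨.terminal b t'', rfl⟩
  | nonterminal r hr ch rest ihc ihr =>
    rcases hc : ch.next with _ | ⟨b, l₁, ch'⟩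
    · simp only [next, hc] at h
      obtain ⟨s, hs⟩ := ihr h t''
      exact ⟨.nonterminal r hr ch s, by simp only [next, hc, hs]⟩
    · simp only [next, hc, Option.some.injEq, Prod.mk.injEq] at h
      obtain ⟨rfl, h⟩ := h
      cases h
      obtain ⟨t₁, t₂, rfl⟩ := t''.exists_eq_append
      obtain ⟨s, hs⟩ := ihc hc t₁
      exact ⟨.nonterminal r hr s t₂, by simp only [next, hs]⟩

/-- The automaton that guesses a leftmost derivation. Its states are the sentential forms in `St`;
it reads a letter of `T` by expanding nonterminals until the sentential form starts with that
letter. -/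
def stackNFA (g : ContextFreeGrammar.{u} V) (St : Set (List (Symbol V g.NT))) (T : Set V) :
    NFA V St where
  step γ a := {γ' | a ∈ T ∧ ∃ (t : Forest g γ.1) (t' : Forest g γ'.1),
    t.next = some (a, ⟨γ'.1, t'⟩)}
  start := {γ | γ.1 = [Symbol.nonterminal g.initial]}
  accept := {γ | [] ∈ formLanguage g γ.1}

variable {St : Set (List (Symbol V g.NT))} {T : Set V}

theorem mem_formLanguage_of_stackNFA {x : List V} {γ : St}
    (h : x ∈ (stackNFA g St T).acceptsFrom {γ}) : x ∈ formLanguage g γ.1 := by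
  induction x generalizing γ with
  | nil => exact mem_acceptsFrom_singleton_nil.1 h
  | cons a x ih =>
    obtain ⟨γ', ⟨-, t, t', ht⟩, hx⟩ := mem_acceptsFrom_singleton_cons.1 h
    obtain ⟨t'', rfl⟩ := ih hx
    obtain ⟨s, hs⟩ := Forest.exists_next_eq ht t''
    exact ⟨s, (Forest.of_next_eq_some hs).1⟩

theorem mem_stackNFA_of_forest {x : List V} {γ : St} (t : Forest g γ.1) (ht : t.yield = x)
    (hSt : ∀ γ' ∈ t.pending, γ' ∈ St) (hT : ∀ a ∈ x, a ∈ T) :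
    x ∈ (stackNFA g St T).acceptsFrom {γ} := by
  induction x generalizing γ with
  | nil => exact mem_acceptsFrom_singleton_nil.2 ⟨t, ht⟩
  | cons a x ih =>
    rcases hn : t.next with _ | ⟨b, l', t'⟩
    · rw [(Forest.of_next_eq_none hn).1] at ht
      cases ht
    · obtain ⟨h1, h2⟩ := Forest.of_next_eq_some hn
      rw [h1] at ht
      obtain ⟨rfl, hx⟩ := List.cons_eq_cons.1 ht
      rw [h2] at hSt
      refine mem_acceptsFrom_singleton_cons.2 ⟨⟨l', hSt _ List.mem_cons_self⟩, ?_, ?_⟩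
      · exact ⟨hT _ List.mem_cons_self, t, t', hn⟩
      · exact ih (γ := ⟨l', _⟩) t' hx (fun γ' h => hSt _ (List.mem_cons_of_mem _ h))
          fun c h => hT _ (List.mem_cons_of_mem _ h)

/-- Two runs on a word lift to two forests with the same yield; if these are equal, then so are the
stacks that remain after their first terminals. -/
theorem stackNFA_runUnique (hg : GrammarUnambiguous g) : RunUnique (stackNFA g St T) := by
  refine ⟨fun γ => ∀ t t' : Forest g γ.1, t.yield = t'.yield → t = t', ?_, ?_, ?_, ?_⟩
  · rintro ⟨γ, hγ⟩ (rfl : γ = _)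
    exact hg
  · rintro γ a hγ γ' ⟨-, t, t', ht⟩ s s' hss
    obtain ⟨r, hr⟩ := Forest.exists_next_eq ht s
    obtain ⟨r', hr'⟩ := Forest.exists_next_eq ht s'
    obtain rfl : r = r' := hγ r r' <| by
      rw [(Forest.of_next_eq_some hr).1, (Forest.of_next_eq_some hr').1, hss]
    rw [hr] at hr'
    simpa using hr'
  · rintro x γ hγ γ' hγ' - -
    exact Subtype.ext (Eq.trans hγ (Eq.symm hγ'))
  · rintro γ a x hγ γ₁ ⟨-, t₁, t₁', h₁⟩ γ₂ ⟨-, t₂, t₂', h₂⟩ hx₁ hx₂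
    obtain ⟨s₁, hs₁⟩ := mem_formLanguage_of_stackNFA hx₁
    obtain ⟨s₂, hs₂⟩ := mem_formLanguage_of_stackNFA hx₂
    obtain ⟨r, hr⟩ := Forest.exists_next_eq h₁ s₁
    obtain ⟨r', hr'⟩ := Forest.exists_next_eq h₂ s₂
    obtain rfl : r = r' := hγ r r' <| by
      rw [(Forest.of_next_eq_some hr).1, (Forest.of_next_eq_some hr').1, hs₁, hs₂]
    rw [hr] at hr'
    simp only [Option.some.injEq, Prod.mk.injEq, Sigma.mk.injEq, true_and] at hr'
    exact Subtype.ext hr'.1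

end StackAutomaton

/-! ### Derivation trees without repetitions -/

section RepetitionFree

variable {V : Type u} {g : ContextFreeGrammar.{u} V}

/-- The nonterminals at the nodes of a forest. -/
def Forest.labels : {l : List (Symbol V g.NT)} → Forest g l → Set g.NT
  | _, .nil => ∅
  | _, .terminal _ rest => rest.labels
  | _, .nonterminal r _ ch rest => insert r.input (ch.labels ∪ rest.labels)

/-- No nonterminal occurs twice on a path from a root to a leaf. -/
def Forest.RepetitionFree : {l : List (Symbol V g.NT)} → Forest g l → Prop
  | _, .nil => True
  | _, .terminal _ rest => rest.RepetitionFree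
  | _, .nonterminal r _ ch rest => r.input ∉ ch.labels ∧ ch.RepetitionFree ∧ rest.RepetitionFree

/-- The number of nodes of a forest. -/
def Forest.count : {l : List (Symbol V g.NT)} → Forest g l → ℕ
  | _, .nil => 0
  | _, .terminal _ rest => rest.count + 1
  | _, .nonterminal _ _ ch rest => ch.count + rest.count + 1

theorem Forest.count_append {l l' : List (Symbol V g.NT)} (t : Forest g l) (t' : Forest g l') :
    (t.append t').count = t.count + t'.count := by
  induction t with
  | nil => simp [append, count]
  | terminal a rest ih => simp only [append, count, ih]; omega
  | nonterminal r hr ch rest _ ih => simp only [append, count, ih]; omega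

theorem Forest.labels_append {l l' : List (Symbol V g.NT)} (t : Forest g l) (t' : Forest g l') :
    (t.append t').labels = t.labels ∪ t'.labels := by
  induction t with
  | nil => simp [append, labels]
  | terminal a rest ih => simp only [append, labels, ih]
  | nonterminal r hr ch rest _ ih =>
    simp only [append, labels, ih, Set.insert_union, Set.union_assoc]

/-- A nonterminal that labels a node is the root of a subtree, whose yield is a factor of the
whole yield. -/
theorem Forest.exists_subtree {l : List (Symbol V g.NT)} (t : Forest g l) {A : g.NT}
    (hA : A ∈ t.labels) : ∃ s : Forest g [Symbol.nonterminal A],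
      s.count ≤ t.count ∧ s.labels ⊆ t.labels ∧ ∃ x y, t.yield = x ++ s.yield ++ y := by
  induction t with
  | nil => exact hA.elim
  | terminal a rest ih =>
    obtain ⟨s, h1, h2, x, y, h3⟩ := ih hA
    exact ⟨s, h1.trans (Nat.le_succ _), h2, a :: x, y, by simp [yield, h3]⟩
  | nonterminal r hr ch rest ihc ihr =>
    rcases hA with rfl | hA | hA
    · refine ⟨.nonterminal r hr ch .nil, by simp [count], ?_, [], rest.yield, by simp [yield]⟩
      simp only [labels, Set.union_empty]
      exact Set.insert_subset_insert Set.subset_union_left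
    · obtain ⟨s, h1, h2, x, y, h3⟩ := ihc hA
      refine ⟨s, by simp only [count]; omega, ?_, x, y ++ rest.yield, by simp [yield, h3]⟩
      exact h2.trans (Set.subset_union_left.trans (Set.subset_insert _ _))
    · obtain ⟨s, h1, h2, x, y, h3⟩ := ihr hA
      refine ⟨s, by simp only [count]; omega, ?_, ch.yield ++ x, y, by simp [yield, h3]⟩
      exact h2.trans (Set.subset_union_right.trans (Set.subset_insert _ _))

theorem UniformLength.of_mul_left {L M : Language V} (h : UniformLength (L * M)) {y : List V}
    (hy : y ∈ M) : UniformLength L := by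
  obtain ⟨k, hk⟩ := h
  refine ⟨k - y.length, fun x hx => ?_⟩
  have := hk _ (Language.append_mem_mul hx hy)
  rw [List.length_append] at this
  omega

theorem UniformLength.of_mul_right {L M : Language V} (h : UniformLength (L * M)) {x : List V}
    (hx : x ∈ L) : UniformLength M := by
  obtain ⟨k, hk⟩ := h
  refine ⟨k - x.length, fun y hy => ?_⟩
  have := hk _ (Language.append_mem_mul hx hy)
  rw [List.length_append] at this
  omega

/-- In a sentential form with a uniform-length language, each word has a forest without
repetitions: if `A` occurs below `A`, then both trees have the same yield, because the lengths
agree, and the upper one can be replaced by the lower one. -/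
theorem Forest.exists_repetitionFree (n : ℕ) {l : List (Symbol V g.NT)} (t : Forest g l)
    (hn : t.count ≤ n) (hl : UniformLength (formLanguage g l)) :
    ∃ t' : Forest g l, t'.yield = t.yield ∧ t'.labels ⊆ t.labels ∧ t'.RepetitionFree := by
  induction n using Nat.strong_induction_on generalizing l with
  | _ n ih =>
    cases t with
    | nil => exact ⟨.nil, rfl, subset_rfl, trivial⟩
    | terminal a rest =>
      simp only [count] at hn
      rw [formLanguage_cons] at hl
      have h1 := hl.of_mul_right ⟨.terminal a .nil, rfl⟩
      obtain ⟨rest', h2, h3, h4⟩ := ih rest.count (by omega) rest le_rfl h1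
      exact ⟨.terminal a rest', by simp [yield, h2], h3, h4⟩
    | @nonterminal r hr l ch rest =>
      simp only [count] at hn
      have hl' := hl
      rw [formLanguage_cons] at hl
      have h1 := hl.of_mul_right (x := ch.yield)
        (mem_formLanguage_nonterminal.2 ⟨r, hr, rfl, ch, rfl⟩)
      obtain ⟨k, hk⟩ := hl.of_mul_left ⟨rest, rfl⟩
      by_cases hA : r.input ∈ ch.labels
      · obtain ⟨s, hs1, hs2, x, y, hs3⟩ := ch.exists_subtree hA
        have hs4 : ch.yield = s.yield := by
          have h5 := hk ch.yield (mem_formLanguage_nonterminal.2 ⟨r, hr, rfl, ch, rfl⟩)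
          have h6 := hk s.yield ⟨s, rfl⟩
          rw [hs3, List.length_append, List.length_append] at h5
          obtain rfl : x = [] := List.length_eq_zero_iff.1 (by omega)
          obtain rfl : y = [] := List.length_eq_zero_iff.1 (by omega)
          simpa using hs3
        obtain ⟨t', h2, h3, h4⟩ := ih (s.append rest).count
          (by rw [count_append]; omega) (s.append rest) le_rfl hl'
        refine ⟨t', ?_, h3.trans ?_, h4⟩
        · rw [h2, yield_append, yield, hs4]
        · rw [labels_append, labels]
          exact (Set.union_subset_union_left _ hs2).trans (Set.subset_insert _ _)
      · obtain ⟨ch', h2, h3, h4⟩ := ih ch.count (by omega) ch le_rfl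
          ⟨k, fun w hw => hk w (mem_formLanguage_nonterminal.2 ⟨r, hr, rfl, hw⟩)⟩
        obtain ⟨rest', h5, h6, h7⟩ := ih rest.count (by omega) rest le_rfl h1
        refine ⟨.nonterminal r hr ch' rest', by rw [yield, yield, h2, h5], ?_,
          fun h => hA (h3 h), h4, h7⟩
        exact Set.insert_subset_insert (Set.union_subset_union h3 h6)

open Classical in
/-- `IsStack U l γ`: the sentential form `γ` may remain to the right of a terminal of a forest with
root labels `l` in which the nonterminals on each path are distinct elements of `U`. -/
inductive IsStack (g : ContextFreeGrammar.{u} V) :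
    Finset g.NT → List (Symbol V g.NT) → List (Symbol V g.NT) → Prop
  | terminal (U : Finset g.NT) (a : V) (l : List (Symbol V g.NT)) :
      IsStack g U (Symbol.terminal a :: l) l
  | skip (U : Finset g.NT) (x : Symbol V g.NT) (l γ : List (Symbol V g.NT)) :
      IsStack g U l γ → IsStack g U (x :: l) γ
  | nested (U : Finset g.NT) (r : ContextFreeRule V g.NT) (l γ : List (Symbol V g.NT)) :
      r ∈ g.rules → r.input ∈ U → IsStack g (U.erase r.input) r.output γ →
        IsStack g U (Symbol.nonterminal r.input :: l) (γ ++ l)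

/-- The set `U` may shrink along a path, because the nonterminals on the path are distinct. -/
theorem Forest.isStack_of_mem_pending {l : List (Symbol V g.NT)} (t : Forest g l)
    (ht : t.RepetitionFree) {U : Finset g.NT} (hU : t.labels ⊆ U)
    {γ : List (Symbol V g.NT)} (hγ : γ ∈ t.pending) : IsStack g U l γ := by
  classical
  induction t generalizing U γ with
  | nil => simp [pending] at hγ
  | terminal a rest ih =>
    rw [pending] at hγ
    rcases List.mem_cons.1 hγ with rfl | hγ
    · exact .terminal U a _
    · exact .skip U _ _ _ (ih ht hU hγ)
  | nonterminal r hr ch rest ihc ihr =>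
    obtain ⟨h1, h2, h3⟩ := ht
    rw [labels, Set.insert_subset_iff, Set.union_subset_iff] at hU
    obtain ⟨h4, h5, h6⟩ := hU
    rw [pending] at hγ
    rcases List.mem_append.1 hγ with hγ | hγ
    · obtain ⟨γ, hγ', rfl⟩ := List.mem_map.1 hγ
      refine .nested U r _ _ hr h4 (ihc h2 (fun A hA => ?_) hγ')
      rw [Finset.mem_coe, Finset.mem_erase]
      exact ⟨fun h => h1 (h ▸ hA), h5 hA⟩
    · exact .skip U _ _ _ (ihr h3 h6 hγ)

open Classical in
/-- The total length of the right-hand sides of the rules for `A`. -/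
noncomputable def ruleLength (g : ContextFreeGrammar.{u} V) (A : g.NT) : ℕ :=
  ∑ r ∈ g.rules with r.input = A, r.output.length

/-- The number of stacks is at most the sum over all ways of choosing a rule and a position in it
for each nonterminal of `U` on a path, which is bounded by a product over `U`. -/
theorem exists_finset_isStack (U : Finset g.NT) (l : List (Symbol V g.NT)) :
    ∃ F : Finset (List (Symbol V g.NT)), (∀ γ, IsStack g U l γ → γ ∈ F) ∧
      F.card ≤ l.length * ∏ A ∈ U, (1 + ruleLength g A) := by
  classical
  induction U using Finset.strongInduction generalizing l with
  | _ U ihU =>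
    have hpos : 1 ≤ ∏ A ∈ U, (1 + ruleLength g A) :=
      Finset.one_le_prod' fun A _ => Nat.le_add_right 1 _
    induction l with
    | nil => exact ⟨∅, fun γ h => (by cases h), by simp⟩
    | cons x l ih =>
      obtain ⟨F, hF, hFc⟩ := ih
      rw [List.length_cons, add_mul, one_mul]
      cases x with
      | terminal a =>
        refine ⟨insert l F, fun γ h => ?_, (Finset.card_insert_le _ _).trans (by omega)⟩
        cases h with
        | terminal => exact Finset.mem_insert_self _ _
        | skip _ _ _ _ h => exact Finset.mem_insert_of_mem (hF _ h)
      | nonterminal A =>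
        by_cases hA : A ∈ U
        · choose G hG hGc using fun l => ihU _ (Finset.erase_ssubset hA) l
          refine ⟨F ∪ (g.rules.filter fun r => r.input = A).biUnion
            fun r => (G r.output).image (· ++ l), fun γ h => ?_, ?_⟩
          · cases h with
            | skip _ _ _ _ h => exact Finset.mem_union_left _ (hF _ h)
            | nested _ r _ γ hr hU h =>
              refine Finset.mem_union_right _ (Finset.mem_biUnion.2 ⟨r, ?_, ?_⟩)
              · exact Finset.mem_filter.2 ⟨hr, rfl⟩
              · exact Finset.mem_image_of_mem _ (hG _ _ h)
          · refine (Finset.card_union_le _ _).trans (Nat.add_le_add hFc ?_)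
            refine Finset.card_biUnion_le.trans ?_
            rw [← Finset.mul_prod_erase U _ hA]
            refine (Finset.sum_le_sum fun r _ =>
              Finset.card_image_le.trans (hGc r.output)).trans ?_
            rw [← Finset.sum_mul]
            refine Nat.mul_le_mul_right _ ?_
            exact Nat.le_add_left _ _
        · refine ⟨F, fun γ h => ?_, by omega⟩
          cases h with
          | skip _ _ _ _ h => exact hF _ h
          | nested _ r _ γ hr hU h => exact (hA hU).elim

/-- The terminals in the right-hand sides of the rules. -/
def ruleTerminals (g : ContextFreeGrammar.{u} V) : Set V :=
  {a | ∃ r ∈ g.rules, Symbol.terminal a ∈ r.output}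

theorem Forest.mem_of_mem_yield {l : List (Symbol V g.NT)} (t : Forest g l) {a : V}
    (ha : a ∈ t.yield) : Symbol.terminal a ∈ l ∨ a ∈ ruleTerminals g := by
  induction t with
  | nil => simp [yield] at ha
  | terminal b rest ih =>
    rw [yield] at ha
    rcases List.mem_cons.1 ha with rfl | ha
    · exact Or.inl List.mem_cons_self
    · exact (ih ha).imp_left (List.mem_cons_of_mem _)
  | nonterminal r hr ch rest ihc ihr =>
    rw [yield] at ha
    rcases List.mem_append.1 ha with ha | ha
    · exact Or.inr ((ihc ha).elim (fun h => ⟨r, hr, h⟩) id)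
    · exact (ihr ha).imp_left (List.mem_cons_of_mem _)

theorem le_concatSize {S : Type u} (α : List S) : α.length ≤ concatSize α := by
  unfold concatSize
  split_ifs <;> omega

theorem sum_length_le_grammarSize (g : ContextFreeGrammar.{u} V) :
    ∑ r ∈ g.rules, r.output.length ≤ grammarSize g :=
  (Finset.sum_le_sum fun r _ => le_concatSize r.output).trans (Nat.le_add_right _ _)

theorem finite_ruleTerminals_and_ncard_le (g : ContextFreeGrammar.{u} V) :
    (ruleTerminals g).Finite ∧ (ruleTerminals g).ncard ≤ grammarSize g := by
  classical
  set p : Symbol V g.NT → Option V := fun x => match x with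
    | .terminal a => some a
    | .nonterminal _ => none with hp
  have h : ruleTerminals g ⊆ (g.rules.biUnion fun r => (r.output.filterMap p).toFinset) := by
    rintro a ⟨r, hr, ha⟩
    rw [Finset.mem_coe, Finset.mem_biUnion]
    exact ⟨r, hr, List.mem_toFinset.2 (List.mem_filterMap.2 ⟨_, ha, rfl⟩)⟩
  refine ⟨(Finset.finite_toSet _).subset h, (Set.ncard_le_ncard h (Finset.finite_toSet _)).trans ?_⟩
  rw [Set.ncard_coe_finset]
  refine Finset.card_biUnion_le.trans ((Finset.sum_le_sum fun r _ => ?_).trans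
    (sum_length_le_grammarSize g))
  exact (List.toFinset_card_le _).trans (List.length_filterMap_le _ _)

/-- Finitely many stacks, at most `2 ^ n` for a grammar of size `n`, suffice to derive all words. -/
theorem exists_finset_pending (g : ContextFreeGrammar.{u} V)
    (hg : UniformLength g.language) :
    ∃ F : Finset (List (Symbol V g.NT)), F.card ≤ 2 ^ grammarSize g ∧
      ∀ x ∈ g.language, ∃ t : DerivationTree g, t.yield = x ∧ ∀ γ ∈ t.pending, γ ∈ F := by
  classical
  obtain ⟨F, hF, hFc⟩ := exists_finset_isStack (g.rules.image ContextFreeRule.input)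
    [Symbol.nonterminal g.initial]
  refine ⟨F, hFc.trans ?_, fun x hx => ?_⟩
  · rw [List.length_singleton, one_mul]
    have h1 : ∏ A ∈ g.rules.image ContextFreeRule.input, (1 + ruleLength g A) ≤
        ∏ A ∈ g.rules.image ContextFreeRule.input, 2 ^ ruleLength g A :=
      Finset.prod_le_prod' fun A _ => by
        rw [add_comm]
        exact Nat.lt_two_pow_self
    refine h1.trans ?_
    rw [Finset.prod_pow_eq_pow_sum]
    refine Nat.pow_le_pow_right two_pos ((le_of_eq ?_).trans (sum_length_le_grammarSize g))
    exact Finset.sum_fiberwise_of_maps_to (fun r hr => Finset.mem_image_of_mem _ hr) _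
  · rw [language_eq_formLanguage] at hx hg
    obtain ⟨t, rfl⟩ := hx
    obtain ⟨t', h1, -, h2⟩ := t.exists_repetitionFree _ le_rfl hg
    refine ⟨t', h1, fun γ hγ => hF γ (t'.isStack_of_mem_pending h2 ?_ hγ)⟩
    clear hγ h1 h2 hF hFc hg
    generalize [Symbol.nonterminal g.initial] = l at t'
    induction t' with
    | nil => exact Set.empty_subset _
    | terminal a rest ih => exact ih
    | nonterminal r hr ch rest ihc ihr =>
      exact Set.insert_subset (Finset.mem_coe.2 (Finset.mem_image_of_mem _ hr))
        (Set.union_subset ihc ihr)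

/-- An automaton of size `2 ^ O(n)` for a grammar of size `n` with a uniform-length language,
unambiguous if the grammar is. -/
theorem exists_finAutomaton_of_grammar (g : ContextFreeGrammar.{u} V)
    (hg : UniformLength g.language) :
    ∃ A : FinAutomaton V, A.nfa.accepts = g.language ∧
      A.size ≤ 2 ^ (4 * (grammarSize g + 1)) ∧ (GrammarUnambiguous g → A.Unambiguous) := by
  classical
  obtain ⟨F, hFc, hF⟩ := exists_finset_pending g hg
  set n := grammarSize g with hn
  set St : Set (List (Symbol V g.NT)) :=
    ((insert [Symbol.nonterminal g.initial] F : Finset (List (Symbol V g.NT))) :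
      Set (List (Symbol V g.NT))) with hSt
  obtain ⟨hT, hTc⟩ := finite_ruleTerminals_and_ncard_le g
  set M := stackNFA g St (ruleTerminals g) with hM
  have hStc : Nat.card St ≤ 2 ^ n + 1 := by
    rw [hSt, Nat.card_coe_set_eq, Set.ncard_coe_finset]
    exact (Finset.card_insert_le _ _).trans (Nat.add_le_add_right hFc 1)
  have hsub : {t : St × V × St | t.2.2 ∈ M.step t.1 t.2.1} ⊆
      Set.univ ×ˢ ruleTerminals g ×ˢ Set.univ := by
    rintro ⟨p, a, q⟩ h
    exact ⟨trivial, h.1, trivial⟩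
  have hfin : (Set.univ ×ˢ ruleTerminals g ×ˢ Set.univ : Set (St × V × St)).Finite :=
    Set.finite_univ.prod (hT.prod Set.finite_univ)
  obtain ⟨A, h1, h2, h3, -⟩ := exists_finAutomaton M (hfin.subset hsub)
  refine ⟨A, ?_, ?_, fun h => h3 (stackNFA_runUnique h)⟩
  · rw [h1]
    ext x
    rw [mem_accepts_iff_exists]
    constructor
    · rintro ⟨⟨γ, hγ⟩, (rfl : γ = _), hx⟩
      rw [language_eq_formLanguage]
      exact mem_formLanguage_of_stackNFA hx
    · intro hx
      obtain ⟨t, ht, hst⟩ := hF x hx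
      refine ⟨⟨_, Finset.mem_coe.2 (Finset.mem_insert_self _ _)⟩, rfl, ?_⟩
      refine mem_stackNFA_of_forest t ht
        (fun γ hγ => Finset.mem_coe.2 (Finset.mem_insert_of_mem (hst γ hγ))) fun a ha => ?_
      rw [← ht] at ha
      rcases t.mem_of_mem_yield ha with h | h
      · simp at h
      · exact h
  · have h4 := Set.ncard_le_ncard hsub hfin
    rw [Set.ncard_prod, Set.ncard_prod, Set.ncard_univ] at h4
    have h5 : A.size ≤ (2 ^ n + 1) + (2 ^ n + 1) * (n * (2 ^ n + 1)) := by
      rw [h2]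
      refine Nat.add_le_add hStc (h4.trans ?_)
      exact Nat.mul_le_mul hStc (Nat.mul_le_mul hTc hStc)
    have h6 : 1 ≤ 2 ^ n := Nat.one_le_two_pow
    have h7 : n ≤ 2 ^ n := Nat.lt_two_pow_self.le
    have h8 : 2 ^ (4 * (n + 1)) = 16 * ((2 ^ n * 2 ^ n) * (2 ^ n * 2 ^ n)) := by ring
    rw [h8]
    refine h5.trans ?_
    generalize 2 ^ n = N at *
    have h9 : (N + 1) * (n * (N + 1)) ≤ (2 * N) * (N * (2 * N)) :=
      Nat.mul_le_mul (by omega) (Nat.mul_le_mul h7 (by omega))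
    have h10 : N * N ≤ (N * N) * (N * N) := Nat.le_mul_self _
    have h11 : N ≤ N * N := Nat.le_mul_self _
    have h12 : N * (N * N) ≤ (N * N) * (N * N) := Nat.mul_le_mul_right _ h11
    nlinarith

theorem expBounded_CFGs_NFAs : ExpBounded (CFGs V) (NFAs V) :=
  ⟨4, fun (g : ContextFreeGrammar.{u} V) hg =>
    let ⟨A, h1, h2, _⟩ := exists_finAutomaton_of_grammar g hg
    ⟨A, h1, h2⟩⟩

theorem expBounded_UCFGs_UFAs : ExpBounded (UCFGs V) (UFAs V) :=
  ⟨4, fun g hg =>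
    let ⟨A, h1, h2, h3⟩ := exists_finAutomaton_of_grammar g.1 hg
    ⟨⟨A, h3 g.2⟩, h1, h2⟩⟩

theorem doubleExpBounded_CFGs_WordSets : DoubleExpBounded (CFGs V) (WordSets V) :=
  expBounded_CFGs_NFAs.trans_exp expBounded_NFAs_WordSets

theorem doubleExpBounded_UCFGs_WordSets : DoubleExpBounded (UCFGs V) (WordSets V) :=
  let ⟨C, h⟩ := doubleExpBounded_CFGs_WordSets
  ⟨C, h.precomp (X := UCFGs V) (fun g => g.1) (fun _ => rfl) fun _ => rfl⟩

end RepetitionFree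

/-! ### Layered languages and their automata -/

section Layered

variable {V : Type u} {ι : Type} {K : ℕ} {allowed : ι → ℕ → Set V}

/-- The words of length `K` for which some `i` allows the letter at each position. -/
def layeredLanguage (K : ℕ) (allowed : ι → ℕ → Set V) : Language V :=
  {x | x.length = K ∧ ∃ i, ∀ p (h : p < x.length), x[p] ∈ allowed i p}

theorem uniformLength_layeredLanguage : UniformLength (layeredLanguage K allowed) :=
  ⟨K, fun _ h => h.1⟩

/-- The automaton that guesses `i` and then checks the letters one by one. -/
def layeredNFA (K : ℕ) (allowed : ι → ℕ → Set V) : NFA V (ι × Fin (K + 1)) where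
  step q a := {q' | q'.1 = q.1 ∧ q'.2.1 = q.2.1 + 1 ∧ a ∈ allowed q.1 q.2}
  start := {q | q.2 = 0}
  accept := {q | q.2.1 = K}

theorem mem_layeredNFA_acceptsFrom {x : List V} {q : ι × Fin (K + 1)} :
    x ∈ (layeredNFA K allowed).acceptsFrom {q} ↔
      q.2.1 + x.length = K ∧ ∀ p (h : p < x.length), x[p] ∈ allowed q.1 (q.2.1 + p) := by
  induction x generalizing q with
  | nil =>
    rw [mem_acceptsFrom_singleton_nil]
    exact ⟨fun h => ⟨h, fun p hp => absurd hp (Nat.not_lt_zero p)⟩, fun h => h.1⟩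
  | cons a x ih =>
    rw [mem_acceptsFrom_singleton_cons]
    constructor
    · rintro ⟨q', ⟨h1, h2, h3⟩, hx⟩
      obtain ⟨h4, h5⟩ := ih.1 hx
      rw [h2] at h4
      refine ⟨by rw [List.length_cons]; omega, fun p hp => ?_⟩
      rcases p with _ | p
      · exact h3
      · have := h5 p (by simpa using hp)
        rw [h1, h2] at this
        rwa [List.getElem_cons_succ, ← Nat.add_assoc, Nat.add_right_comm]
    · rintro ⟨h1, h2⟩
      rw [List.length_cons] at h1
      refine ⟨(q.1, ⟨q.2.1 + 1, by omega⟩), ⟨rfl, rfl, h2 0 (by simp)⟩, ih.2 ⟨?_, fun p hp => ?_⟩⟩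
      · change q.2.1 + 1 + x.length = K
        omega
      · have := h2 (p + 1) (by simpa using hp)
        rwa [List.getElem_cons_succ, ← Nat.add_assoc, Nat.add_right_comm] at this

/-- The layered automaton has `K + 1` states for each `i`, and at most one transition for each state
and each letter of `T`. -/
theorem exists_finAutomaton_layered [Finite ι] (T : Finset V) (hT : ∀ i p, allowed i p ⊆ T) :
    ∃ A : FinAutomaton V, A.nfa.accepts = layeredLanguage K allowed ∧
      A.size ≤ Nat.card ι * (K + 1) * (1 + T.card) ∧
      ((∀ (x : List V) (i j : ι), x.length = K → (∀ p (h : p < x.length), x[p] ∈ allowed i p) →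
        (∀ p (h : p < x.length), x[p] ∈ allowed j p) → i = j) → A.Unambiguous) ∧
      (Nat.card ι = 1 → A.Deterministic) := by
  set M := layeredNFA K allowed with hM
  set D := {t : (ι × Fin (K + 1)) × V × (ι × Fin (K + 1)) | t.2.2 ∈ M.step t.1 t.2.1} with hD
  have hdet : ∀ q a, (M.step q a).Subsingleton := by
    rintro q a q₁ ⟨h1, h2, -⟩ q₂ ⟨h3, h4, -⟩
    exact Prod.ext (h1.trans h3.symm) (Fin.ext (h2.trans h4.symm))
  have hmaps : ∀ t ∈ D, (t.1, t.2.1) ∈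
      (Set.univ ×ˢ (T : Set V) : Set ((ι × Fin (K + 1)) × V)) :=
    fun t ht => ⟨trivial, hT _ _ ht.2.2⟩
  have hinj : Set.InjOn (fun t : (ι × Fin (K + 1)) × V × (ι × Fin (K + 1)) => (t.1, t.2.1)) D := by
    rintro ⟨q, a, q₁⟩ h ⟨q', a', q₂⟩ h' e
    obtain ⟨h1, h2⟩ := Prod.mk.inj e
    dsimp only at h1 h2
    subst h1 h2
    exact congrArg (fun r => (q, a, r)) (hdet q a h h')
  have hfin : (Set.univ ×ˢ (T : Set V) : Set ((ι × Fin (K + 1)) × V)).Finite :=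
    Set.finite_univ.prod T.finite_toSet
  have hDfin : D.Finite := Set.Finite.of_injOn hmaps hinj hfin
  have hDcard : D.ncard ≤ Nat.card ι * (K + 1) * T.card := by
    refine (Set.ncard_le_ncard_of_injOn _ hmaps hinj hfin).trans ?_
    rw [Set.ncard_prod, Set.ncard_univ, Nat.card_prod, Nat.card_fin, Set.ncard_coe_finset]
  obtain ⟨A, h1, h2, h3, h4⟩ := exists_finAutomaton M hDfin
  have h2 : A.size = Nat.card (ι × Fin (K + 1)) + D.ncard := h2
  refine ⟨A, ?_, ?_, fun h => h3 ?_, fun h => h4 ?_ hdet⟩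
  · rw [h1]
    ext x
    rw [mem_accepts_iff_exists]
    constructor
    · rintro ⟨⟨i, q⟩, (rfl : q = 0), hx⟩
      obtain ⟨h5, h6⟩ := mem_layeredNFA_acceptsFrom.1 hx
      simp only [Fin.val_zero, zero_add] at h5 h6
      exact ⟨h5, i, h6⟩
    · rintro ⟨h5, i, h6⟩
      refine ⟨(i, 0), rfl, mem_layeredNFA_acceptsFrom.2 ?_⟩
      simp only [Fin.val_zero, zero_add]
      exact ⟨h5, h6⟩
  · rw [h2, Nat.card_prod, Nat.card_fin, Nat.mul_add (_ * _), mul_one]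
    exact Nat.add_le_add_left hDcard _
  · refine ⟨fun _ => True, fun _ _ => trivial, fun _ _ _ _ _ => trivial, ?_,
      fun q a x _ q₁ h₁ q₂ h₂ _ _ => hdet q a h₁ h₂⟩
    rintro x ⟨i, q⟩ (rfl : q = 0) ⟨j, q'⟩ (rfl : q' = 0) hx hx'
    obtain ⟨h5, h6⟩ := mem_layeredNFA_acceptsFrom.1 hx
    obtain ⟨-, h7⟩ := mem_layeredNFA_acceptsFrom.1 hx'
    simp only [Fin.val_zero, zero_add] at h5 h6 h7
    rw [h x i j h5 h6 h7]
  · obtain ⟨hs, ⟨i⟩⟩ := Nat.card_eq_one_iff_unique.1 h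
    refine ⟨(i, 0), ?_⟩
    ext ⟨j, q⟩
    exact ⟨fun h => Prod.ext (Subsingleton.elim _ _) h, fun h => congrArg Prod.snd h⟩

end Layered

/-! ### Probe languages -/

section Probe

variable {V : Type u} {z o e : V} {B : Set V} {N : ℕ}

/-- The letters that are allowed at position `p` when the probe is at position `i`. -/
def probeAllowed (z o e : V) (B : Set V) (N : ℕ) (i : Fin N) (p : ℕ) : Set V :=
  {a | if p = i then a = o else if p < i + N + 1 then a = z ∨ a = o else
    if p = i + N + 1 then a = e else a ∈ B}

/-- The words of length `2 * N + 1` that have, for some `i < N`, the letter `o` at position `i` and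
the letter `e` at position `i + N + 1`; all other letters before the `e` are `z` or `o`, and those
after it are in `B`. -/
def probeLanguage (z o e : V) (B : Set V) (N : ℕ) : Language V :=
  layeredLanguage (2 * N + 1) (probeAllowed z o e B N)

/-- Decomposition of a word at the position `i` of the probe and at position `i + N + 1`. -/
theorem mem_probeLanguage_iff {x : List V} : x ∈ probeLanguage z o e B N ↔
    ∃ y₁ y₂ y₃ : List V, x = y₁ ++ o :: (y₂ ++ e :: y₃) ∧ (∀ a ∈ y₁, a = z ∨ a = o) ∧
      (∀ a ∈ y₂, a = z ∨ a = o) ∧ (∀ a ∈ y₃, a ∈ B) ∧ y₂.length = N ∧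
      y₁.length + y₃.length + 1 = N := by
  constructor
  · rintro ⟨hx, i, hi⟩
    have hiN := i.2
    refine ⟨x.take i, (x.drop (i + 1)).take N, x.drop (i + N + 2), ?_, ?_, ?_, ?_, ?_, ?_⟩
    · have h1 := hi i (by omega)
      have h2 := hi (i + N + 1) (by omega)
      simp only [probeAllowed, if_true, Set.mem_ofPred_eq] at h1
      simp only [probeAllowed, Set.mem_ofPred_eq, lt_irrefl, if_false, if_true,
        if_neg (show ¬ ((i : ℕ) + N + 1 = i) by omega)] at h2
      have h3 : x.drop i = o :: x.drop (i + 1) := by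
        rw [← h1]; exact List.drop_eq_getElem_cons (by omega)
      have h4 : x.drop (i + N + 1) = e :: x.drop (i + N + 2) := by
        rw [← h2]; exact List.drop_eq_getElem_cons (by omega)
      have h5 : (x.drop (i + 1)).drop N = e :: x.drop (i + N + 2) := by
        rw [List.drop_drop, ← h4]; congr 1; omega
      rw [← h5, List.take_append_drop, ← h3, List.take_append_drop]
    · intro a ha
      obtain ⟨p, hp, rfl⟩ := List.getElem_of_mem ha
      rw [List.length_take] at hp
      have h1 := hi p (by omega)
      rw [List.getElem_take]
      simpa only [probeAllowed, Set.mem_ofPred_eq, if_neg (show ¬ (p = i) by omega),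
        if_pos (show p < i + N + 1 by omega)] using h1
    · intro a ha
      obtain ⟨p, hp, rfl⟩ := List.getElem_of_mem ha
      rw [List.length_take, List.length_drop] at hp
      have h1 := hi (i + 1 + p) (by omega)
      rw [List.getElem_take, List.getElem_drop]
      simpa only [probeAllowed, Set.mem_ofPred_eq, if_neg (show ¬ (↑i + 1 + p = i) by omega),
        if_pos (show ↑i + 1 + p < i + N + 1 by omega)] using h1
    · intro a ha
      obtain ⟨p, hp, rfl⟩ := List.getElem_of_mem ha
      rw [List.length_drop] at hp
      have h1 := hi (i + N + 2 + p) (by omega)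
      rw [List.getElem_drop]
      simpa only [probeAllowed, Set.mem_ofPred_eq, if_neg (show ¬ (↑i + N + 2 + p = i) by omega),
        if_neg (show ¬ (↑i + N + 2 + p < i + N + 1) by omega),
        if_neg (show ¬ (↑i + N + 2 + p = i + N + 1) by omega)] using h1
    · rw [List.length_take, List.length_drop]
      omega
    · rw [List.length_take, List.length_drop]
      omega
  · rintro ⟨y₁, y₂, y₃, rfl, h1, h2, h3, h4, h5⟩
    refine ⟨by simp only [List.length_append, List.length_cons]; omega,
      ⟨y₁.length, by omega⟩, fun p hp => ?_⟩
    simp only [probeAllowed, Set.mem_ofPred_eq]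
    simp only [List.length_append, List.length_cons] at hp
    rcases lt_trichotomy p y₁.length with h | rfl | h
    · rw [if_neg h.ne, if_pos (by omega), List.getElem_append_left h]
      exact h1 _ (List.getElem_mem _)
    · rw [if_pos rfl, List.getElem_append_right le_rfl]
      simp
    · obtain ⟨q, rfl⟩ : ∃ q, p = y₁.length + (q + 1) := ⟨p - y₁.length - 1, by omega⟩
      rw [if_neg h.ne', List.getElem_append_right (by omega)]
      simp only [Nat.add_sub_cancel_left, List.getElem_cons_succ]
      rcases lt_trichotomy q y₂.length with h' | rfl | h'
      · rw [if_pos (by omega), List.getElem_append_left h']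
        exact h2 _ (List.getElem_mem _)
      · rw [if_neg (by omega), if_pos (by omega), List.getElem_append_right le_rfl]
        simp
      · obtain ⟨r, rfl⟩ : ∃ r, q = y₂.length + (r + 1) := ⟨q - y₂.length - 1, by omega⟩
        rw [if_neg (by omega), if_neg (by omega), List.getElem_append_right (by omega)]
        simp only [Nat.add_sub_cancel_left, List.getElem_cons_succ]
        exact h3 _ (List.getElem_mem _)

open Classical in
/-- The characteristic word of a set of positions. -/
noncomputable def charWord (z o : V) (S : Finset (Fin N)) : List V :=
  List.ofFn fun i => if i ∈ S then o else z

theorem length_charWord (S : Finset (Fin N)) : (charWord z o S).length = N := by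
  simp [charWord]

theorem mem_charWord {S : Finset (Fin N)} {a : V} (ha : a ∈ charWord z o S) : a = z ∨ a = o := by
  obtain ⟨i, rfl⟩ := (List.mem_ofFn' _ _).1 ha
  dsimp only
  split_ifs <;> simp

theorem getElem_charWord (S : Finset (Fin N)) {p : ℕ} (hp : p < (charWord z o S).length)
    (hzo : z ≠ o) (hp' : p < N) : (charWord z o S)[p] = o ↔ (⟨p, hp'⟩ : Fin N) ∈ S := by
  simp only [charWord, List.getElem_ofFn]
  split_ifs with h <;> simp [h, hzo]

theorem charWord_injective (hzo : z ≠ o) :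
    Function.Injective (charWord z o : Finset (Fin N) → List V) := by
  intro S T h
  ext ⟨p, hp⟩
  rw [← getElem_charWord (z := z) (o := o) S (by rwa [length_charWord]) hzo hp,
    ← getElem_charWord (z := z) (o := o) T (by rwa [length_charWord]) hzo hp]
  simp only [h]

/-- A probe at the first position leaves the following `N` letters free. -/
theorem mem_probeLanguage_charWord {b : V} (hb : b ∈ B) (hN : 0 < N) (S : Finset (Fin N)) :
    o :: (charWord z o S ++ e :: List.replicate (N - 1) b) ∈ probeLanguage z o e B N := by
  refine mem_probeLanguage_iff.2 ⟨[], charWord z o S, List.replicate (N - 1) b, rfl, by simp,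
    fun a ha => mem_charWord ha, fun a ha => ?_, length_charWord S, ?_⟩
  · rw [List.eq_of_mem_replicate ha]
    exact hb
  · simp only [List.length_nil, List.length_replicate]
    omega

/-- A finite set of words that contains an injective image of the subsets of `Fin N` has `2 ^ N`
elements at least. -/
theorem two_pow_le_wordSets_size {y : Finset (List V)} (f : Finset (Fin N) → List V)
    (hf : Function.Injective f) (hfy : ∀ S, f S ∈ y) : 2 ^ N ≤ (WordSets V).size y := by
  have h1 := Finset.card_le_card_of_injOn f (s := Finset.univ) (t := y) (fun S _ => hfy S)
    hf.injOn
  rw [Finset.card_univ, Fintype.card_finset, Fintype.card_fin] at h1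
  refine h1.trans ?_
  change y.card ≤ ∑ x ∈ y, (x.length + 1)
  rw [Finset.card_eq_sum_ones]
  exact Finset.sum_le_sum fun x _ => by omega

theorem probeLanguage_wordSets_lower {b : V} (hb : b ∈ B) (hzo : z ≠ o) (hN : 0 < N)
    (y : (WordSets V).Obj) (hy : (WordSets V).lang y = probeLanguage z o e B N) :
    2 ^ N ≤ (WordSets V).size y := by
  refine two_pow_le_wordSets_size
    (fun S => o :: (charWord z o S ++ e :: List.replicate (N - 1) b)) (fun S T h => ?_) fun S => ?_
  · refine charWord_injective hzo (List.append_inj_left (List.cons_injective h) ?_)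
    rw [length_charWord, length_charWord]
  · have := mem_probeLanguage_charWord (z := z) (o := o) (e := e) hb hN S
    rw [← hy] at this
    exact this

theorem probeLanguage_nfa_lower {b : V} (hb : b ∈ B) (hN : 0 < N) (A : FinAutomaton V)
    (hA : A.nfa.accepts = probeLanguage z o e B N) : 2 * N + 1 ≤ A.size := by
  have h := mem_probeLanguage_charWord (z := z) (o := o) (e := e) hb hN ∅
  have h1 := A.length_le_size (hA ▸ uniformLength_layeredLanguage) (hA ▸ h)
  rwa [h.1] at h1

/-! ### Lower bounds for deterministic automata -/

theorem FinAutomaton.Deterministic.subsingleton_eval {A : FinAutomaton V} (h : A.Deterministic)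
    (x : List V) : (A.nfa.eval x).Subsingleton := by
  induction x using List.reverseRecOn with
  | nil =>
    obtain ⟨s, hs⟩ := h.1
    rw [NFA.eval_nil, hs]
    exact Set.subsingleton_singleton
  | append_singleton x a ih =>
    rw [NFA.eval_append_singleton]
    intro q hq q' hq'
    obtain ⟨p, hp, hq⟩ := NFA.mem_stepSet.1 hq
    obtain ⟨p', hp', hq'⟩ := NFA.mem_stepSet.1 hq'
    obtain rfl := ih hp hp'
    exact h.2 _ _ hq hq'

/-- Words that are pairwise distinguished by their continuations lead a deterministic automaton to
different states, or, for at most one of them, to no state. -/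
theorem FinAutomaton.Deterministic.card_le {A : FinAutomaton V} (h : A.Deterministic)
    {κ : Type*} (f : κ → List V)
    (hf : ∀ i j, (∀ y, f i ++ y ∈ A.nfa.accepts ↔ f j ++ y ∈ A.nfa.accepts) → i = j) :
    Nat.card κ ≤ A.size + 1 := by
  classical
  have := A.finite_state
  set F : κ → Option A.State := fun i =>
    if hi : (A.nfa.eval (f i)).Nonempty then some hi.some else none with hF
  have heval : ∀ i, A.nfa.eval (f i) = {q | F i = some q} := by
    intro i
    ext q
    rw [Set.mem_ofPred_eq, hF]
    dsimp only
    split_ifs with hi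
    · rw [Option.some_inj]
      exact ⟨fun hq => h.subsingleton_eval _ hi.some_mem hq, fun hq => hq ▸ hi.some_mem⟩
    · rw [Set.not_nonempty_iff_eq_empty.1 hi]
      simp
  have hinj : Function.Injective F := by
    intro i j hij
    refine hf i j fun y => ?_
    rw [NFA.accepts_eq_acceptsFrom_start, NFA.append_mem_acceptsFrom, NFA.append_mem_acceptsFrom]
    change y ∈ A.nfa.acceptsFrom (A.nfa.eval (f i)) ↔ y ∈ A.nfa.acceptsFrom (A.nfa.eval (f j))
    rw [heval, heval, hij]
  refine (Nat.card_le_card_of_injective F hinj).trans ?_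
  rw [Finite.card_option]
  exact Nat.add_le_add_right (Nat.le_add_right _ _) 1

/-- The position of the first letter `d` selects the position that is probed. -/
theorem exists_probe_continuation {d : V} (hdz : d ≠ z) (hdo : d ≠ o) (hzo : z ≠ o) (i : Fin N) :
    ∃ y : List V, ∀ S : Finset (Fin N),
      charWord z o S ++ y ∈ probeLanguage z o d {d} N ↔ i ∈ S := by
  have hiN := i.2
  -- The `d`s start at position `i + N + 1`, just where they do for a probe at position `i`.
  refine ⟨List.replicate (i + 1) z ++ List.replicate (N - i) d, fun S => ?_⟩
  set x := charWord z o S ++ (List.replicate (i + 1) z ++ List.replicate (N - i) d) with hx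
  have hlen : x.length = 2 * N + 1 := by
    simp only [hx, List.length_append, length_charWord, List.length_replicate]
    omega
  have h1 : ∀ p (hp : p < x.length) (h : p < N),
      x[p] = (charWord z o S)[p]'(by rwa [length_charWord]) := fun p hp h => by
    simp only [hx]
    rw [List.getElem_append_left]
  have h2 : ∀ p (hp : p < x.length), N ≤ p → p < i + N + 1 → x[p] = z := fun p hp h h' => by
    simp only [hx]
    rw [List.getElem_append_right (by rwa [length_charWord]), List.getElem_append_left,
      List.getElem_replicate]
    rw [length_charWord, List.length_replicate]
    omega
  have h3 : ∀ p (hp : p < x.length), i + N + 1 ≤ p → x[p] = d := fun p hp h => by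
    simp only [hx]
    rw [List.getElem_append_right (by rw [length_charWord]; omega), List.getElem_append_right,
      List.getElem_replicate]
    rw [length_charWord, List.length_replicate]
    omega
  constructor
  · rintro ⟨-, j, hj⟩
    have hjN := j.2
    have h4 := hj (j + N + 1) (by omega)
    have h5 := hj (i + N + 1) (by omega)
    have h6 := hj j (by omega)
    simp only [probeAllowed, Set.mem_ofPred_eq, lt_irrefl, if_false, if_true,
      if_neg (show ¬ ((j : ℕ) + N + 1 = j) by omega)] at h4
    simp only [probeAllowed, Set.mem_ofPred_eq, if_true] at h6
    rw [h3 _ _ le_rfl] at h5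
    have h7 : (i : ℕ) ≤ j := by
      by_contra! hlt
      rw [h2 _ _ (by omega) (by omega)] at h4
      exact hdz h4.symm
    have h8 : (j : ℕ) ≤ i := by
      by_contra! hlt
      simp only [probeAllowed, Set.mem_ofPred_eq, if_neg (show ¬ ((i : ℕ) + N + 1 = j) by omega),
        if_pos (show (i : ℕ) + N + 1 < j + N + 1 by omega), hdz, hdo, or_self] at h5
    obtain rfl : i = j := Fin.ext (le_antisymm h7 h8)
    rw [h1 _ _ hiN] at h6
    exact (getElem_charWord S _ hzo hiN).1 h6
  · intro hi
    refine ⟨hlen, i, fun p hp => ?_⟩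
    simp only [probeAllowed, Set.mem_ofPred_eq]
    split_ifs with h4 h5 h6
    · subst h4
      rw [h1 _ _ hiN]
      exact (getElem_charWord S _ hzo hiN).2 hi
    · by_cases h : p < N
      · rw [h1 _ _ h]
        exact mem_charWord (List.getElem_mem _)
      · exact Or.inl (h2 _ _ (by omega) h5)
    · exact h3 _ _ h6.ge
    · exact h3 _ _ (by omega)

theorem probeLanguage_dfa_lower {d : V} (hdz : d ≠ z) (hdo : d ≠ o) (hzo : z ≠ o)
    (A : FinAutomaton V) (hA : A.Deterministic)
    (hl : A.nfa.accepts = probeLanguage z o d {d} N) : 2 ^ N ≤ A.size + 1 := by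
  have := hA.card_le (κ := Finset (Fin N)) (charWord z o) fun S T h => by
    ext i
    obtain ⟨y, hy⟩ := exists_probe_continuation hdz hdo hzo i
    rw [← hy S, ← hy T, ← hl]
    exact h y
  rwa [Nat.card_eq_fintype_card, Fintype.card_finset, Fintype.card_fin] at this

/-- The first letter `d` determines the probed position. -/
theorem probe_unique {d : V} (hdz : d ≠ z) (hdo : d ≠ o) (x : List V) (i j : Fin N)
    (hx : x.length = 2 * N + 1)
    (hi : ∀ p (h : p < x.length), x[p] ∈ probeAllowed z o d {d} N i p)
    (hj : ∀ p (h : p < x.length), x[p] ∈ probeAllowed z o d {d} N j p) : i = j := by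
  -- By symmetry it suffices to exclude that one position is smaller than the other.
  have key : ∀ i j : Fin N, (∀ p (h : p < x.length), x[p] ∈ probeAllowed z o d {d} N i p) →
      (∀ p (h : p < x.length), x[p] ∈ probeAllowed z o d {d} N j p) → ¬ (i : ℕ) < j := by
    intro i j hi hj hij
    have hjN := j.2
    have h1 := hi (i + N + 1) (by omega)
    have h2 := hj (i + N + 1) (by omega)
    simp only [probeAllowed, Set.mem_ofPred_eq, lt_irrefl, if_false, if_true,
      if_neg (show ¬ ((i : ℕ) + N + 1 = i) by omega)] at h1
    simp only [probeAllowed, Set.mem_ofPred_eq, if_neg (show ¬ ((i : ℕ) + N + 1 = j) by omega),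
        if_pos (show (i : ℕ) + N + 1 < j + N + 1 by omega), h1, hdz, hdo, or_self] at h2
  have h1 := key i j hi hj
  have h2 := key j i hj hi
  exact Fin.ext (by omega)

/-! ### Lower bounds for unambiguous automata -/

theorem exists_accepting_path {Q : Type w} {M : NFA V Q} {x y : List V} {r q : Q}
    (hq : q ∈ M.evalFrom {r} x) (hy : y ∈ M.acceptsFrom {q}) :
    ∃ t : M.accept, Nonempty (M.Path r t (x ++ y)) := by
  have h : x ++ y ∈ M.acceptsFrom {r} :=
    (NFA.append_mem_acceptsFrom M).2 (mem_acceptsFrom_iff_exists.2 ⟨q, hq, hy⟩)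
  obtain ⟨t, ht, h⟩ := h
  exact ⟨⟨t, ht⟩, NFA.mem_evalFrom_iff_nonempty_path.1 h⟩

/-- If at most one accepting run on `x ++ y` leaves `s`, then accepting runs agree on the state
between `x` and `y`. -/
theorem path_middle_unique {Q : Type w} {M : NFA V Q} {y : List V} {q₁ q₂ : Q} (x : List V)
    {s : Q} (hs : Subsingleton (Σ t : M.accept, M.Path s t (x ++ y)))
    (h₁ : q₁ ∈ M.evalFrom {s} x) (h₂ : q₂ ∈ M.evalFrom {s} x)
    (hy₁ : y ∈ M.acceptsFrom {q₁}) (hy₂ : y ∈ M.acceptsFrom {q₂}) : q₁ = q₂ := by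
  induction x generalizing s with
  | nil =>
    rw [NFA.evalFrom_nil] at h₁ h₂
    exact Eq.trans h₁ (Eq.symm h₂)
  | cons a x ih =>
    rw [NFA.evalFrom_cons, NFA.stepSet_singleton, NFA.mem_evalFrom_iff_exists] at h₁ h₂
    obtain ⟨r₁, hr₁, h₁⟩ := h₁
    obtain ⟨r₂, hr₂, h₂⟩ := h₂
    obtain ⟨t₁, ⟨p₁⟩⟩ := exists_accepting_path h₁ hy₁
    obtain ⟨t₂, ⟨p₂⟩⟩ := exists_accepting_path h₂ hy₂
    have h := hs.elim ⟨t₁, .cons r₁ s t₁ a _ hr₁ p₁⟩ ⟨t₂, .cons r₂ s t₂ a _ hr₂ p₂⟩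
    have hr : r₁ = r₂ := by
      cases h
      rfl
    subst hr
    refine ih ⟨?_⟩ h₁ h₂
    rintro ⟨t, p⟩ ⟨t', p'⟩
    have h := hs.elim ⟨t, .cons r₁ s t a _ hr₁ p⟩ ⟨t', .cons r₁ s t' a _ hr₁ p'⟩
    cases h
    rfl

theorem FinAutomaton.Unambiguous.middle_unique {A : FinAutomaton V} (h : A.Unambiguous)
    {x y : List V} {q₁ q₂ : A.State} (h₁ : q₁ ∈ A.nfa.eval x) (h₂ : q₂ ∈ A.nfa.eval x)
    (hy₁ : y ∈ A.nfa.acceptsFrom {q₁}) (hy₂ : y ∈ A.nfa.acceptsFrom {q₂}) : q₁ = q₂ := by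
  obtain ⟨s₁, hs₁, h₁⟩ := NFA.mem_evalFrom_iff_exists.1 h₁
  obtain ⟨s₂, hs₂, h₂⟩ := NFA.mem_evalFrom_iff_exists.1 h₂
  obtain ⟨t₁, ⟨p₁⟩⟩ := exists_accepting_path h₁ hy₁
  obtain ⟨t₂, ⟨p₂⟩⟩ := exists_accepting_path h₂ hy₂
  have hs : s₁ = s₂ := by
    have := (h (x ++ y)).elim ⟨⟨s₁, hs₁⟩, t₁, p₁⟩ ⟨⟨s₂, hs₂⟩, t₂, p₂⟩
    cases this
    rfl
  subst hs
  refine path_middle_unique x ⟨?_⟩ h₁ h₂ hy₁ hy₂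
  rintro ⟨t, p⟩ ⟨t', p'⟩
  have := (h (x ++ y)).elim ⟨⟨s₁, hs₁⟩, t, p⟩ ⟨⟨s₁, hs₁⟩, t', p'⟩
  cases this
  rfl

open Classical in
/-- The incidence matrix of inclusion. -/
noncomputable def inclusionMatrix (N : ℕ) : Matrix (Finset (Fin N)) (Finset (Fin N)) ℚ :=
  fun S T => if S ⊆ T then 1 else 0

/-- Inclusion is a partial order, so the inclusion matrix is invertible by triangularity. -/
theorem rank_inclusionMatrix (N : ℕ) : (inclusionMatrix N).rank = 2 ^ N := by
  classical
  have hinj : Function.Injective fun c => Matrix.vecMul c (inclusionMatrix N) := by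
    intro c c' h
    rw [← sub_eq_zero] at h ⊢
    have h : Matrix.vecMul (c - c') (inclusionMatrix N) = 0 := by rw [Matrix.sub_vecMul]; exact h
    generalize c - c' = c at h
    funext T
    induction T using Finset.strongInduction with
    | _ T ih =>
      have h1 : ∑ S, c S * inclusionMatrix N S T = 0 := congrFun h T
      rw [Finset.sum_eq_single T] at h1
      · simpa [inclusionMatrix] using h1
      · intro S _ hST
        by_cases hsub : S ⊆ T
        · rw [ih S (hsub.ssubset_of_ne hST)]
          simp
        · simp [inclusionMatrix, hsub]
      · simp
  rw [Matrix.rank_of_isUnit _ (Matrix.vecMul_injective_iff_isUnit.1 hinj), Fintype.card_finset,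
    Fintype.card_fin]

/-- A probe compares position `i` of the first block with position `i` of the second block. -/
theorem mem_probeLanguage_pair (hzo : z ≠ o) (S T : Finset (Fin N)) :
    charWord z o S ++ z :: charWord z o T ∈ probeLanguage z o o {a | a = z ∨ a = o} N ↔
      ∃ i, i ∈ S ∧ i ∈ T := by
  set x := charWord z o S ++ z :: charWord z o T with hx
  have hlen : x.length = 2 * N + 1 := by
    simp only [hx, List.length_append, length_charWord, List.length_cons]
    omega
  have hmem : ∀ a ∈ x, a = z ∨ a = o := by
    intro a ha
    rw [hx, List.mem_append, List.mem_cons] at ha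
    rcases ha with ha | rfl | ha
    · exact mem_charWord ha
    · exact Or.inl rfl
    · exact mem_charWord ha
  have h1 : ∀ (i : Fin N) (hp : i.1 < x.length), x[i.1] = o ↔ i ∈ S := fun i hp => by
    rw [← getElem_charWord (z := z) (o := o) S (by rw [length_charWord]; exact i.2) hzo i.2]
    simp only [hx]
    rw [List.getElem_append_left]
  have h2 : ∀ (i : Fin N) (hp : i.1 + N + 1 < x.length), x[i.1 + N + 1] = o ↔ i ∈ T := by
    intro i hp
    rw [← getElem_charWord (z := z) (o := o) T (by rw [length_charWord]; exact i.2) hzo i.2]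
    simp only [hx]
    rw [List.getElem_append_right (by rw [length_charWord]; omega)]
    simp only [length_charWord, show i.1 + N + 1 - N = i.1 + 1 by omega, List.getElem_cons_succ]
  constructor
  · rintro ⟨-, i, hi⟩
    have hiN := i.2
    have h3 := hi i (by omega)
    have h4 := hi (i + N + 1) (by omega)
    simp only [probeAllowed, Set.mem_ofPred_eq, if_true] at h3
    simp only [probeAllowed, Set.mem_ofPred_eq, lt_irrefl, if_false, if_true,
      if_neg (show ¬ ((i : ℕ) + N + 1 = i) by omega)] at h4
    exact ⟨i, (h1 i _).1 h3, (h2 i _).1 h4⟩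
  · rintro ⟨i, hS, hT⟩
    refine ⟨hlen, i, fun p hp => ?_⟩
    simp only [probeAllowed, Set.mem_ofPred_eq]
    split_ifs with h4 h5 h6
    · subst h4
      exact (h1 i hp).2 hS
    · exact hmem _ (List.getElem_mem _)
    · subst h6
      exact (h2 i hp).2 hT
    · exact hmem _ (List.getElem_mem _)

/-- Splitting the accepting runs at the state that is reached in the middle shows that the
intersection matrix has rank at most the number of states. Adding one to the bound accounts for the
difference between the intersection matrix and the inclusion matrix, which is invertible. -/
theorem probeLanguage_ufa_lower (hzo : z ≠ o) (A : FinAutomaton V) (hA : A.Unambiguous)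
    (hl : A.nfa.accepts = probeLanguage z o o {a | a = z ∨ a = o} N) : 2 ^ N ≤ A.size + 1 := by
  classical
  have := A.finite_state
  have : Fintype A.State := Fintype.ofFinite _
  -- The additional index `none` contributes the constant matrix `1`, from which the intersection
  -- matrix is subtracted.
  set P : Matrix (Finset (Fin N)) (Option A.State) ℚ := fun S q => match q with
    | none => 1
    | some q => if q ∈ A.nfa.eval (charWord z o S) then -1 else 0 with hP
  set R : Matrix (Option A.State) (Finset (Fin N)) ℚ := fun q T => match q with
    | none => 1
    | some q => if z :: charWord z o Tᶜ ∈ A.nfa.acceptsFrom {q} then 1 else 0 with hR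
  have hmul : inclusionMatrix N = P * R := by
    ext S T
    rw [Matrix.mul_apply, Fintype.sum_option]
    simp only [hP, hR, mul_one]
    have hword : charWord z o S ++ z :: charWord z o Tᶜ ∈ A.nfa.accepts ↔
        ∃ q ∈ A.nfa.eval (charWord z o S), z :: charWord z o Tᶜ ∈ A.nfa.acceptsFrom {q} := by
      rw [NFA.accepts_eq_acceptsFrom_start, NFA.append_mem_acceptsFrom,
        mem_acceptsFrom_iff_exists]
      rfl
    rw [hl, mem_probeLanguage_pair hzo] at hword
    by_cases hST : S ⊆ T
    · rw [inclusionMatrix, if_pos hST, Finset.sum_eq_zero, add_zero]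
      intro q _
      have h1 : ¬ ∃ i, i ∈ S ∧ i ∈ Tᶜ := by
        rintro ⟨i, hi, hi'⟩
        exact Finset.mem_compl.1 hi' (hST hi)
      rw [hword] at h1
      by_cases h2 : q ∈ A.nfa.eval (charWord z o S)
      · rw [if_neg (fun h3 => h1 ⟨q, h2, h3⟩), mul_zero]
      · rw [if_neg h2, zero_mul]
    · obtain ⟨i, hi, hi'⟩ := Finset.not_subset.1 hST
      obtain ⟨q, hq, hq'⟩ := hword.1 ⟨i, hi, Finset.mem_compl.2 hi'⟩
      rw [inclusionMatrix, if_neg hST, Finset.sum_eq_single q, if_pos hq, if_pos hq']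
      · norm_num
      · intro r _ hr
        by_cases h2 : r ∈ A.nfa.eval (charWord z o S)
        · rw [if_neg (fun h3 => hr (hA.middle_unique h2 hq h3 hq')), mul_zero]
        · rw [if_neg h2, zero_mul]
      · simp
  have h1 : (inclusionMatrix N).rank ≤ Fintype.card (Option A.State) := by
    rw [hmul]
    exact (Matrix.rank_mul_le_left P R).trans (Matrix.rank_le_card_width P)
  rw [rank_inclusionMatrix, Fintype.card_option, ← Nat.card_eq_fintype_card] at h1
  exact h1.trans (Nat.add_le_add_right (Nat.le_add_right _ _) 1)

end Probe

/-! ### Grammars of logarithmic size for probe languages -/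

/-- The nonterminals of the grammars for probe languages. -/
inductive ProbeNT : Type
  /-- generates the words of length `2 ^ k` over the two letters `z` and `o` -/
  | bits (k : ℕ) : ProbeNT
  /-- generates the words of length `2 ^ k` over the letters that may follow the probe -/
  | tail (k : ℕ) : ProbeNT
  /-- generates a probe, together with a block of `bits` on its left and a block of `tail` letters
  on its right of total length `2 ^ k - 1` -/
  | probe (k : ℕ) : ProbeNT

section ProbeGrammar

open ProbeNT Symbol

variable {V : Type u} {z o e : V} {B : Finset V} {n : ℕ}

open Classical in
/-- The rules of the grammar for the probe language with `N = 2 ^ n`. Doubling generates blocks of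
length `2 ^ k`; the two rules for `probe (k + 1)` put a block of length `2 ^ k` to the left or to
the right, according to a binary digit of the position of the probe. -/
noncomputable def probeRules (z o e : V) (B : Finset V) (n : ℕ) :
    Finset (ContextFreeRule V ProbeNT) :=
  {⟨bits 0, [terminal z]⟩, ⟨bits 0, [terminal o]⟩,
      ⟨probe 0, [terminal o, nonterminal (bits n), terminal e]⟩} ∪
    (B.image fun b => ⟨tail 0, [terminal b]⟩) ∪
    (Finset.range n).image (fun k =>
      ⟨bits (k + 1), [nonterminal (bits k), nonterminal (bits k)]⟩) ∪
    (Finset.range n).image (fun k =>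
      ⟨tail (k + 1), [nonterminal (tail k), nonterminal (tail k)]⟩) ∪
    (Finset.range n).image (fun k =>
      ⟨probe (k + 1), [nonterminal (bits k), nonterminal (probe k)]⟩) ∪
    (Finset.range n).image (fun k =>
      ⟨probe (k + 1), [nonterminal (probe k), nonterminal (tail k)]⟩)

/-- Membership in `probeRules` as an inductive predicate, for case distinctions. -/
inductive IsProbeRule (z o e : V) (B : Finset V) (n : ℕ) : ContextFreeRule V ProbeNT → Prop
  | zero : IsProbeRule z o e B n ⟨bits 0, [terminal z]⟩
  | one : IsProbeRule z o e B n ⟨bits 0, [terminal o]⟩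
  | tail_zero (b : V) (hb : b ∈ B) : IsProbeRule z o e B n ⟨tail 0, [terminal b]⟩
  | probe_zero : IsProbeRule z o e B n
      ⟨probe 0, [terminal o, nonterminal (bits n), terminal e]⟩
  | bits_succ (k : ℕ) (hk : k < n) : IsProbeRule z o e B n
      ⟨bits (k + 1), [nonterminal (bits k), nonterminal (bits k)]⟩
  | tail_succ (k : ℕ) (hk : k < n) : IsProbeRule z o e B n
      ⟨tail (k + 1), [nonterminal (tail k), nonterminal (tail k)]⟩
  | left (k : ℕ) (hk : k < n) : IsProbeRule z o e B n
      ⟨probe (k + 1), [nonterminal (bits k), nonterminal (probe k)]⟩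
  | right (k : ℕ) (hk : k < n) : IsProbeRule z o e B n
      ⟨probe (k + 1), [nonterminal (probe k), nonterminal (tail k)]⟩

theorem mem_probeRules_iff {r : ContextFreeRule V ProbeNT} :
    r ∈ probeRules z o e B n ↔ IsProbeRule z o e B n r := by
  classical
  simp only [probeRules, Finset.mem_union, Finset.mem_insert, Finset.mem_singleton,
    Finset.mem_image, Finset.mem_range]
  constructor
  · rintro ((((((rfl | rfl | rfl) | ⟨b, hb, rfl⟩) | ⟨k, hk, rfl⟩) | ⟨k, hk, rfl⟩) |
      ⟨k, hk, rfl⟩) | ⟨k, hk, rfl⟩)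
    exacts [.zero, .one, .probe_zero, .tail_zero b hb, .bits_succ k hk, .tail_succ k hk,
      .left k hk, .right k hk]
  · rintro (_ | _ | ⟨b, hb⟩ | _ | ⟨k, hk⟩ | ⟨k, hk⟩ | ⟨k, hk⟩ | ⟨k, hk⟩)
    · simp
    · simp
    · exact Or.inl (Or.inl (Or.inl (Or.inl (Or.inr ⟨b, hb, rfl⟩))))
    · simp
    · exact Or.inl (Or.inl (Or.inl (Or.inr ⟨k, hk, rfl⟩)))
    · exact Or.inl (Or.inl (Or.inr ⟨k, hk, rfl⟩))
    · exact Or.inl (Or.inr ⟨k, hk, rfl⟩)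
    · exact Or.inr ⟨k, hk, rfl⟩

theorem card_probeRules_le : (probeRules z o e B n).card ≤ 4 * n + B.card + 3 := by
  classical
  have h1 : ∀ f : ℕ → ContextFreeRule V ProbeNT, ((Finset.range n).image f).card ≤ n := fun f =>
    Finset.card_image_le.trans (Finset.card_range n).le
  unfold probeRules
  refine (Finset.card_union_le _ _).trans ((Nat.add_le_add ((Finset.card_union_le _ _).trans
    (Nat.add_le_add ((Finset.card_union_le _ _).trans (Nat.add_le_add
      ((Finset.card_union_le _ _).trans (Nat.add_le_add ((Finset.card_union_le _ _).trans
        (Nat.add_le_add Finset.card_le_three Finset.card_image_le)) (h1 _))) (h1 _)))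
          (h1 _))) (h1 _)).trans ?_)
  omega

/-- The grammar for the probe language with `N = 2 ^ n`. -/
noncomputable abbrev probeGrammar (z o e : V) (B : Finset V) (n : ℕ) :
    ContextFreeGrammar.{u} V where
  NT := ProbeNT
  initial := probe n
  rules := probeRules z o e B n

theorem grammarSize_probeGrammar_le (hB : B.card ≤ 2) :
    grammarSize (probeGrammar z o e B n) ≤ 30 * (n + 1) := by
  have h1 : ∑ r ∈ probeRules z o e B n, concatSize r.output ≤
      (probeRules z o e B n).card * 5 := by
    refine Finset.sum_le_card_nsmul _ _ _ fun r hr => ?_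
    have h3 : r.output.length ≤ 3 := by
      cases mem_probeRules_iff.1 hr <;> simp
    unfold concatSize
    split_ifs <;> omega
  have h2 := card_probeRules_le (z := z) (o := o) (e := e) (B := B) (n := n)
  refine (grammarSize_le _).trans ?_
  change ∑ r ∈ probeRules z o e B n, concatSize r.output + (probeRules z o e B n).card ≤ _
  omega

/-- The language that each nonterminal is meant to generate. -/
def probeInterp (z o e : V) (B : Finset V) (n : ℕ) : ProbeNT → Language V
  | bits k => {x | x.length = 2 ^ k ∧ ∀ a ∈ x, a = z ∨ a = o}
  | tail k => {x | x.length = 2 ^ k ∧ ∀ a ∈ x, a ∈ B}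
  | probe k => {x | ∃ y₁ y₂ y₃ : List V, x = y₁ ++ o :: (y₂ ++ e :: y₃) ∧
      (∀ a ∈ y₁, a = z ∨ a = o) ∧ (∀ a ∈ y₂, a = z ∨ a = o) ∧ (∀ a ∈ y₃, a ∈ B) ∧
      y₂.length = 2 ^ n ∧ y₁.length + y₃.length + 1 = 2 ^ k}

/-- The interpretation of terminals and nonterminals. -/
def probeSymbolInterp (z o e : V) (B : Finset V) (n : ℕ) : Symbol V ProbeNT → Language V
  | terminal a => {[a]}
  | nonterminal A => probeInterp z o e B n A

/-- The rules are sound for the intended languages. -/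
theorem probeInterp_closed {r : ContextFreeRule V ProbeNT} (hr : r ∈ probeRules z o e B n)
    {x : List V} (hx : x ∈ (r.output.map (probeSymbolInterp z o e B n)).prod) :
    x ∈ probeInterp z o e B n r.input := by
  cases mem_probeRules_iff.1 hr with
  | zero =>
    simp only [List.map_cons, List.map_nil, List.prod_cons, List.prod_nil, mul_one] at hx
    obtain rfl : x = [z] := hx
    exact ⟨rfl, by simp⟩
  | one =>
    simp only [List.map_cons, List.map_nil, List.prod_cons, List.prod_nil, mul_one] at hx
    obtain rfl : x = [o] := hx
    exact ⟨rfl, by simp⟩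
  | tail_zero b hb =>
    simp only [List.map_cons, List.map_nil, List.prod_cons, List.prod_nil, mul_one] at hx
    obtain rfl : x = [b] := hx
    exact ⟨rfl, by simpa using hb⟩
  | probe_zero =>
    simp only [List.map_cons, List.map_nil, List.prod_cons, List.prod_nil, mul_one,
      Language.mem_mul] at hx
    obtain ⟨_, rfl, _, ⟨y, hy, _, rfl, rfl⟩, rfl⟩ := hx
    exact ⟨[], y, [], rfl, by simp, hy.2, by simp, hy.1, rfl⟩
  | bits_succ k hk =>
    simp only [List.map_cons, List.map_nil, List.prod_cons, List.prod_nil, mul_one,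
      Language.mem_mul] at hx
    obtain ⟨y, hy, y', hy', rfl⟩ := hx
    refine ⟨by rw [List.length_append, hy.1, hy'.1, pow_succ, mul_two], fun a ha => ?_⟩
    exact (List.mem_append.1 ha).elim (hy.2 a) (hy'.2 a)
  | tail_succ k hk =>
    simp only [List.map_cons, List.map_nil, List.prod_cons, List.prod_nil, mul_one,
      Language.mem_mul] at hx
    obtain ⟨y, hy, y', hy', rfl⟩ := hx
    refine ⟨by rw [List.length_append, hy.1, hy'.1, pow_succ, mul_two], fun a ha => ?_⟩
    exact (List.mem_append.1 ha).elim (hy.2 a) (hy'.2 a)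
  | left k hk =>
    simp only [List.map_cons, List.map_nil, List.prod_cons, List.prod_nil, mul_one,
      Language.mem_mul] at hx
    obtain ⟨y, hy, _, ⟨y₁, y₂, y₃, rfl, h1, h2, h3, h4, h5⟩, rfl⟩ := hx
    refine ⟨y ++ y₁, y₂, y₃, by simp, fun a ha => ?_, h2, h3, h4, ?_⟩
    · exact (List.mem_append.1 ha).elim (hy.2 a) (h1 a)
    · rw [List.length_append, hy.1, pow_succ]
      omega
  | right k hk =>
    simp only [List.map_cons, List.map_nil, List.prod_cons, List.prod_nil, mul_one,
      Language.mem_mul] at hx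
    obtain ⟨_, ⟨y₁, y₂, y₃, rfl, h1, h2, h3, h4, h5⟩, y, hy, rfl⟩ := hx
    refine ⟨y₁, y₂, y₃ ++ y, by simp, h1, h2, fun a ha => ?_, h4, ?_⟩
    · exact (List.mem_append.1 ha).elim (h3 a) (hy.2 a)
    · rw [List.length_append, hy.1, pow_succ]
      omega

theorem mem_prod_of_mem_probeGrammar {l : List (Symbol V ProbeNT)} {x : List V}
    (hx : x ∈ formLanguage (probeGrammar z o e B n) l) :
    x ∈ (l.map (probeSymbolInterp z o e B n)).prod :=
  mem_prod_of_mem_formLanguage (g := probeGrammar z o e B n) (probeInterp z o e B n)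
    (probeSymbolInterp z o e B n) (fun _ => rfl) (fun _ => rfl)
    (fun _ hr _ hx => probeInterp_closed hr hx) hx

theorem mem_probeInterp_of_mem {A : ProbeNT} {x : List V}
    (hx : x ∈ formLanguage (probeGrammar z o e B n) [nonterminal A]) :
    x ∈ probeInterp z o e B n A := by
  have := mem_prod_of_mem_probeGrammar hx
  rwa [List.map_singleton, List.prod_singleton] at this

theorem mem_of_probeRule {A : ProbeNT} {l : List (Symbol V ProbeNT)} {x : List V}
    (h : IsProbeRule z o e B n ⟨A, l⟩) (hx : x ∈ formLanguage (probeGrammar z o e B n) l) :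
    x ∈ formLanguage (probeGrammar z o e B n) [nonterminal A] :=
  mem_formLanguage_nonterminal.2 ⟨_, mem_probeRules_iff.2 h, rfl, hx⟩

theorem mem_terminal (g : ContextFreeGrammar.{u} V) (a : V) : [a] ∈ formLanguage g [terminal a] :=
  ⟨.terminal a .nil, rfl⟩

theorem append_mem_formLanguage_cons {g : ContextFreeGrammar.{u} V} {s : Symbol V g.NT}
    {l : List (Symbol V g.NT)} {x y : List V} (hx : x ∈ formLanguage g [s])
    (hy : y ∈ formLanguage g l) : x ++ y ∈ formLanguage g (s :: l) := by
  rw [formLanguage_cons]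
  exact Language.append_mem_mul hx hy

theorem mem_bits {k : ℕ} (hk : k ≤ n) {x : List V} (hx : x ∈ probeInterp z o e B n (bits k)) :
    x ∈ formLanguage (probeGrammar z o e B n) [nonterminal (bits k)] := by
  induction k generalizing x with
  | zero =>
    obtain ⟨h1, h2⟩ := hx
    obtain ⟨a, rfl⟩ := List.length_eq_one_iff.1 h1
    rcases h2 a (by simp) with rfl | rfl
    · exact mem_of_probeRule .zero (mem_terminal _ _)
    · exact mem_of_probeRule .one (mem_terminal _ _)
  | succ k ih =>
    obtain ⟨h1, h2⟩ := hx
    rw [pow_succ] at h1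
    rw [← List.take_append_drop (2 ^ k) x]
    refine mem_of_probeRule (.bits_succ k hk) (append_mem_formLanguage_cons
      (ih (by omega) ⟨?_, fun a ha => h2 a (List.mem_of_mem_take ha)⟩)
      (ih (by omega) ⟨?_, fun a ha => h2 a (List.mem_of_mem_drop ha)⟩))
    · rw [List.length_take]; omega
    · rw [List.length_drop]; omega

theorem mem_tail {k : ℕ} (hk : k ≤ n) {x : List V} (hx : x ∈ probeInterp z o e B n (tail k)) :
    x ∈ formLanguage (probeGrammar z o e B n) [nonterminal (tail k)] := by
  induction k generalizing x with
  | zero =>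
    obtain ⟨h1, h2⟩ := hx
    obtain ⟨a, rfl⟩ := List.length_eq_one_iff.1 h1
    exact mem_of_probeRule (.tail_zero a (h2 a (by simp))) (mem_terminal _ _)
  | succ k ih =>
    obtain ⟨h1, h2⟩ := hx
    rw [pow_succ] at h1
    rw [← List.take_append_drop (2 ^ k) x]
    refine mem_of_probeRule (.tail_succ k hk) (append_mem_formLanguage_cons
      (ih (by omega) ⟨?_, fun a ha => h2 a (List.mem_of_mem_take ha)⟩)
      (ih (by omega) ⟨?_, fun a ha => h2 a (List.mem_of_mem_drop ha)⟩))
    · rw [List.length_take]; omega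
    · rw [List.length_drop]; omega

theorem mem_probe {k : ℕ} (hk : k ≤ n) {x : List V} (hx : x ∈ probeInterp z o e B n (probe k)) :
    x ∈ formLanguage (probeGrammar z o e B n) [nonterminal (probe k)] := by
  induction k generalizing x with
  | zero =>
    obtain ⟨y₁, y₂, y₃, rfl, h1, h2, h3, h4, h5⟩ := hx
    rw [pow_zero] at h5
    obtain rfl : y₁ = [] := List.length_eq_zero_iff.1 (by omega)
    obtain rfl : y₃ = [] := List.length_eq_zero_iff.1 (by omega)
    exact mem_of_probeRule .probe_zero (append_mem_formLanguage_cons (x := [o]) (mem_terminal _ o)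
      (append_mem_formLanguage_cons (mem_bits le_rfl ⟨h4, h2⟩) (mem_terminal _ e)))
  | succ k ih =>
    obtain ⟨y₁, y₂, y₃, rfl, h1, h2, h3, h4, h5⟩ := hx
    rw [pow_succ] at h5
    -- Exactly one of the blocks `y₁` and `y₃` has length at least `2 ^ k`.
    by_cases hy : 2 ^ k ≤ y₁.length
    · rw [← List.take_append_drop (2 ^ k) y₁, List.append_assoc]
      refine mem_of_probeRule (.left k hk) (append_mem_formLanguage_cons
        (mem_bits (by omega) ⟨?_, fun a ha => h1 a (List.mem_of_mem_take ha)⟩)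
        (ih (by omega) ⟨_, y₂, y₃, rfl, fun a ha => h1 a (List.mem_of_mem_drop ha), h2, h3,
          h4, ?_⟩))
      · rw [List.length_take]; omega
      · rw [List.length_drop]; omega
    · obtain ⟨m, hm⟩ : ∃ m, m + 2 ^ k = y₃.length := ⟨y₃.length - 2 ^ k, by omega⟩
      have hsplit : y₁ ++ o :: (y₂ ++ e :: y₃) =
          (y₁ ++ o :: (y₂ ++ e :: y₃.take m)) ++ y₃.drop m := by
        simp
      rw [hsplit]
      refine mem_of_probeRule (.right k hk) (append_mem_formLanguage_cons
        (ih (by omega) ⟨y₁, y₂, _, rfl, h1, h2, fun a ha => h3 a (List.mem_of_mem_take ha),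
          h4, ?_⟩)
        (mem_tail (by omega) ⟨?_, fun a ha => h3 a (List.mem_of_mem_drop ha)⟩))
      · rw [List.length_take]; omega
      · rw [List.length_drop]; omega

theorem language_probeGrammar :
    (probeGrammar z o e B n).language = probeLanguage z o e B (2 ^ n) := by
  ext x
  rw [language_eq_formLanguage, mem_probeLanguage_iff]
  exact ⟨mem_probeInterp_of_mem, mem_probe le_rfl⟩

open Classical in
theorem count_probe {d : V} (hdz : d ≠ z) (hdo : d ≠ o) {y₁ y₂ y₃ : List V}
    (h1 : ∀ a ∈ y₁, a = z ∨ a = o) (h2 : ∀ a ∈ y₂, a = z ∨ a = o)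
    (h3 : ∀ a ∈ y₃, a ∈ ({d} : Finset V)) :
    (y₁ ++ o :: (y₂ ++ d :: y₃)).count d = y₃.length + 1 := by
  have hbits : ∀ y : List V, (∀ a ∈ y, a = z ∨ a = o) → y.count d = 0 := fun y hy =>
    List.count_eq_zero.2 fun h => (hy d h).elim hdz hdo
  have h4 : y₃.count d = y₃.length :=
    List.count_eq_length.2 fun a ha => (Finset.mem_singleton.1 (h3 a ha)).symm
  rw [List.count_append, List.count_cons_of_ne hdo.symm, List.count_append, List.count_cons_self,
    hbits y₁ h1, hbits y₂ h2, h4]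
  omega

/-- When the probe ends with a letter `d` that is repeated until the end of the word, the number of
occurrences of `d` determines the position of the probe, and hence the derivation tree. -/
theorem grammarUnambiguous_probeGrammar {d : V} (hdz : d ≠ z) (hdo : d ≠ o) (hzo : z ≠ o) :
    GrammarUnambiguous (probeGrammar z o d {d} n) := by
  classical
  refine fun t t' h => Forest.eq_of_yield_eq (fun A => ?_) ?_ t t' h
  · cases A with
    | bits k => exact ⟨2 ^ k, fun x hx => (mem_probeInterp_of_mem hx).1⟩
    | tail k => exact ⟨2 ^ k, fun x hx => (mem_probeInterp_of_mem hx).1⟩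
    | probe k =>
      refine ⟨2 ^ k + 2 ^ n + 1, fun x hx => ?_⟩
      obtain ⟨y₁, y₂, y₃, rfl, -, -, -, h4, h5⟩ := mem_probeInterp_of_mem hx
      simp only [List.length_append, List.length_cons]
      omega
  · -- The two rules for `probe (k + 1)` differ in whether `d` occurs more than `2 ^ k` times.
    have key : ∀ (k : ℕ) (x : List V), x ∈ formLanguage (probeGrammar z o d {d} n)
        [nonterminal (bits k), nonterminal (probe k)] → x ∉ formLanguage
          (probeGrammar z o d {d} n) [nonterminal (probe k), nonterminal (tail k)] := by
      intro k x hx hx'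
      have h1 := mem_prod_of_mem_probeGrammar hx
      have h2 := mem_prod_of_mem_probeGrammar hx'
      simp only [List.map_cons, List.map_nil, List.prod_cons, List.prod_nil, mul_one,
        Language.mem_mul] at h1 h2
      obtain ⟨y, hy, _, ⟨y₁, y₂, y₃, rfl, h3, h4, h5, -, h6⟩, rfl⟩ := h1
      obtain ⟨_, ⟨y₁', y₂', y₃', rfl, h3', h4', h5', -, h6'⟩, y', hy', heq⟩ := h2
      have h7 : y.count d = 0 := List.count_eq_zero.2 fun h => (hy.2 d h).elim hdz hdo
      have h8 : y'.count d = 2 ^ k := by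
        rw [← hy'.1]
        exact List.count_eq_length.2 fun a ha => (Finset.mem_singleton.1 (hy'.2 a ha)).symm
      have h9 := congrArg (List.count d) heq
      rw [List.count_append (l₂ := y'), List.count_append (l₁ := y),
        count_probe hdz hdo h3 h4 h5, count_probe hdz hdo h3' h4' h5', h7, h8] at h9
      omega
    have hterm : ∀ (a b : V) (x : List V), x ∈ formLanguage (probeGrammar z o d {d} n)
        [terminal a] → x ∈ formLanguage (probeGrammar z o d {d} n) [terminal b] → a = b := by
      intro a b x hx hx'
      rw [formLanguage_terminal] at hx hx'
      obtain rfl : x = [a] := hx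
      exact List.singleton_inj.1 hx'
    intro r hr r' hr' hin x hx hx'
    have h1 := mem_probeRules_iff.1 hr
    have h2 := mem_probeRules_iff.1 hr'
    clear hr hr'
    cases h1 <;> cases h2 <;> first
      | rfl
      | (cases hin; done)
      | exact absurd (hterm _ _ x hx hx') hzo
      | exact absurd (hterm _ _ x hx' hx) hzo
      | (rw [hterm _ _ x hx hx'])
      | (cases hin; rfl)
      | (cases hin; exact (key _ x hx hx').elim)
      | (cases hin; exact (key _ x hx' hx).elim)

end ProbeGrammar

/-! ### Tightness -/

section Tightness

variable {V : Type u} {z o d : V}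

theorem coe_pair_eq (z o : V) [DecidableEq V] :
    (({z, o} : Finset V) : Set V) = {a | a = z ∨ a = o} := by
  ext a
  simp

open Classical in
/-- The unambiguous grammars for the probe languages whose probe ends with a separate letter. -/
noncomputable def probeUCFG (hdz : d ≠ z) (hdo : d ≠ o) (hzo : z ≠ o) (n : ℕ) : (UCFGs V).Obj :=
  ⟨probeGrammar z o d {d} n, grammarUnambiguous_probeGrammar hdz hdo hzo⟩

theorem lang_probeUCFG (hdz : d ≠ z) (hdo : d ≠ o) (hzo : z ≠ o) (n : ℕ) :
    (UCFGs V).lang (probeUCFG hdz hdo hzo n) = probeLanguage z o d {d} (2 ^ n) := by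
  refine Eq.trans (language_probeGrammar (e := d) (B := {d})) ?_
  rw [Finset.coe_singleton]

theorem size_probeUCFG_le (hdz : d ≠ z) (hdo : d ≠ o) (hzo : z ≠ o) (n : ℕ) :
    (UCFGs V).size (probeUCFG hdz hdo hzo n) ≤ 30 * (n + 1) :=
  grammarSize_probeGrammar_le (by simp)

open Classical in
/-- The grammars for the probe languages with only two letters. -/
noncomputable def probeCFG (z o : V) (n : ℕ) : (CFGs V).Obj := probeGrammar z o o {z, o} n

theorem lang_probeCFG (z o : V) (n : ℕ) :
    (CFGs V).lang (probeCFG z o n) = probeLanguage z o o {a | a = z ∨ a = o} (2 ^ n) := by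
  classical
  refine Eq.trans (language_probeGrammar (e := o) (B := {z, o})) ?_
  rw [coe_pair_eq]

theorem size_probeCFG_le (z o : V) (n : ℕ) : (CFGs V).size (probeCFG z o n) ≤ 30 * (n + 1) := by
  classical exact grammarSize_probeGrammar_le Finset.card_le_two

theorem tight_CFGs_NFAs (z o : V) : HasTightTranslation Exponential (CFGs V) (NFAs V) := by
  refine expBounded_CFGs_NFAs.hasTightTranslation (C := 30) (by norm_num) (probeCFG z o)
    (fun m => lang_probeCFG z o m ▸ uniformLength_layeredLanguage) (size_probeCFG_le z o)
    fun m A hA => ?_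
  have := probeLanguage_nfa_lower (b := o) (Or.inr rfl) (Nat.two_pow_pos m) A
    (hA.trans (lang_probeCFG z o m))
  change 2 ^ m ≤ A.size + 1
  omega

theorem tight_UCFGs_UFAs (hdz : d ≠ z) (hdo : d ≠ o) (hzo : z ≠ o) :
    HasTightTranslation Exponential (UCFGs V) (UFAs V) := by
  refine expBounded_UCFGs_UFAs.hasTightTranslation (C := 30) (by norm_num)
    (probeUCFG hdz hdo hzo)
    (fun m => lang_probeUCFG hdz hdo hzo m ▸ uniformLength_layeredLanguage)
    (size_probeUCFG_le hdz hdo hzo) fun m A hA => ?_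
  have := probeLanguage_nfa_lower (B := {d}) (b := d) rfl (Nat.two_pow_pos m) A.1
    (hA.trans (lang_probeUCFG hdz hdo hzo m))
  change 2 ^ m ≤ A.1.size + 1
  omega

theorem tight_CFGs_UFAs (hzo : z ≠ o) :
    HasTightTranslation DoubleExponential (CFGs V) (UFAs V) :=
  (doubleExpBounded_CFGs_WordSets.trans_linear linearBounded_WordSets_UFAs).hasTightTranslation
    (C := 30) (by norm_num) (probeCFG z o)
    (fun m => lang_probeCFG z o m ▸ uniformLength_layeredLanguage) (size_probeCFG_le z o)
    fun m A hA => probeLanguage_ufa_lower hzo A.1 A.2 (hA.trans (lang_probeCFG z o m))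

theorem tight_UCFGs_DFAs (hdz : d ≠ z) (hdo : d ≠ o) (hzo : z ≠ o) :
    HasTightTranslation DoubleExponential (UCFGs V) (DFAs V) :=
  (doubleExpBounded_UCFGs_WordSets.trans_linear linearBounded_WordSets_DFAs).hasTightTranslation
    (C := 30) (by norm_num) (probeUCFG hdz hdo hzo)
    (fun m => lang_probeUCFG hdz hdo hzo m ▸ uniformLength_layeredLanguage)
    (size_probeUCFG_le hdz hdo hzo)
    fun m A hA => probeLanguage_dfa_lower hdz hdo hzo A.1 A.2
      (hA.trans (lang_probeUCFG hdz hdo hzo m))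

theorem tight_CFGs_WordSets (hzo : z ≠ o) :
    HasTightTranslation DoubleExponential (CFGs V) (WordSets V) :=
  doubleExpBounded_CFGs_WordSets.hasTightTranslation (C := 30) (by norm_num) (probeCFG z o)
    (fun m => lang_probeCFG z o m ▸ uniformLength_layeredLanguage) (size_probeCFG_le z o)
    fun m y hy => (probeLanguage_wordSets_lower (b := o) (Or.inr rfl) hzo (Nat.two_pow_pos m) y
      (hy.trans (lang_probeCFG z o m))).trans (Nat.le_succ _)

theorem layered_probe_size_le {m c s : ℕ} (hc : c ≤ 3)
    (hs : s ≤ Nat.card (Fin m) * (2 * m + 1 + 1) * (1 + c)) : s ≤ (3 * (m + 1)) ^ 2 := by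
  rw [Nat.card_fin] at hs
  have h1 : m * (2 * m + 1 + 1) * (1 + c) ≤ m * (2 * m + 1 + 1) * 4 :=
    Nat.mul_le_mul_left _ (by omega)
  nlinarith

theorem tight_NFAs_UFAs (hzo : z ≠ o) :
    HasTightTranslation RootExponential (NFAs V) (UFAs V) := by
  classical
  have h : ∀ m, ∃ A : (NFAs V).Obj,
      (NFAs V).lang A = probeLanguage z o o {a | a = z ∨ a = o} m ∧
        (NFAs V).size A ≤ (3 * (m + 1)) ^ 2 := fun m => by
    obtain ⟨A, h1, h2, -, -⟩ := exists_finAutomaton_layered (K := 2 * m + 1)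
      (allowed := probeAllowed z o o {a | a = z ∨ a = o} m) {z, o} fun i p a ha => by
        rw [coe_pair_eq]
        simp only [probeAllowed, Set.mem_ofPred_eq] at ha
        split_ifs at ha
        exacts [Or.inr ha, ha, Or.inr ha, ha]
    exact ⟨A, h1, layered_probe_size_le (Finset.card_le_two.trans (by norm_num)) h2⟩
  choose A hA hs using h
  exact (expBounded_NFAs_WordSets.trans_linear linearBounded_WordSets_UFAs).hasTightTranslation_root
    (C := 3) (by norm_num) A (fun m => hA m ▸ uniformLength_layeredLanguage) hs
    fun m B hB => probeLanguage_ufa_lower hzo B.1 B.2 (hB.trans (hA m))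

theorem tight_UFAs_DFAs (hdz : d ≠ z) (hdo : d ≠ o) (hzo : z ≠ o) :
    HasTightTranslation RootExponential (UFAs V) (DFAs V) := by
  classical
  have h : ∀ m, ∃ A : (UFAs V).Obj, (UFAs V).lang A = probeLanguage z o d {d} m ∧
      (UFAs V).size A ≤ (3 * (m + 1)) ^ 2 := fun m => by
    obtain ⟨A, h1, h2, h3, -⟩ := exists_finAutomaton_layered (K := 2 * m + 1)
      (allowed := probeAllowed z o d {d} m) {z, o, d} fun i p a ha => by
        simp only [probeAllowed, Set.mem_ofPred_eq, Set.mem_singleton_iff] at ha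
        simp only [Finset.coe_insert, Finset.coe_singleton, Set.mem_insert_iff,
          Set.mem_singleton_iff]
        split_ifs at ha <;> tauto
    exact ⟨⟨A, h3 fun x i j hx => probe_unique hdz hdo x i j hx⟩, h1,
      layered_probe_size_le Finset.card_le_three h2⟩
  choose A hA hs using h
  exact (expBounded_UFAs_WordSets.trans_linear linearBounded_WordSets_DFAs).hasTightTranslation_root
    (C := 3) (by norm_num) A (fun m => hA m ▸ uniformLength_layeredLanguage) hs
    fun m B hB => probeLanguage_dfa_lower hdz hdo hzo B.1 B.2 (hB.trans (hA m))

/-- Linear-size deterministic automata for the sets of all words of length `m` over two letters. -/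
theorem exists_dfa_all_words (hzo : z ≠ o) (m : ℕ) :
    ∃ A : (DFAs V).Obj, UniformLength ((DFAs V).lang A) ∧ (DFAs V).size A ≤ 3 * (m + 1) ∧
      ∀ y : (WordSets V).Obj, (WordSets V).lang y = (DFAs V).lang A →
        2 ^ m ≤ (WordSets V).size y := by
  classical
  obtain ⟨A, h1, h2, -, h4⟩ := exists_finAutomaton_layered (ι := Unit) (K := m)
    (allowed := fun _ _ => {a | a = z ∨ a = o}) {z, o} fun _ _ => (coe_pair_eq z o).ge
  refine ⟨⟨A, h4 Nat.card_unique⟩, ?_, ?_, fun y hy => ?_⟩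
  · have : UniformLength A.nfa.accepts := h1 ▸ uniformLength_layeredLanguage
    exact this
  · refine h2.trans ?_
    have : ({z, o} : Finset V).card ≤ 2 := Finset.card_le_two
    rw [Nat.card_unique, one_mul, mul_comm]
    exact Nat.mul_le_mul_right _ (by omega)
  · refine two_pow_le_wordSets_size (N := m) (charWord z o) (charWord_injective hzo) fun S => ?_
    have hmem : charWord z o S ∈ A.nfa.accepts := by
      rw [h1]
      exact ⟨length_charWord S, (), fun p hp => mem_charWord (List.getElem_mem _)⟩
    exact (Set.ext_iff.1 hy (charWord z o S)).2 hmem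

theorem tight_DFAs_WordSets (hzo : z ≠ o) :
    HasTightTranslation Exponential (DFAs V) (WordSets V) := by
  choose A h1 h2 h3 using exists_dfa_all_words hzo
  exact expBounded_DFAs_WordSets.hasTightTranslation (C := 3) (by norm_num) A h1 h2
    fun m y hy => (h3 m y hy).trans (Nat.le_succ _)

theorem tight_NFAs_WordSets (hzo : z ≠ o) :
    HasTightTranslation Exponential (NFAs V) (WordSets V) := by
  choose A h1 h2 h3 using exists_dfa_all_words hzo
  exact expBounded_NFAs_WordSets.hasTightTranslation (C := 3) (by norm_num) (fun m => (A m).1)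
    h1 h2 fun m y hy => (h3 m y hy).trans (Nat.le_succ _)

end Tightness

end SizeTradeoff

theorem mainTheorem2 {V : Type*} [Infinite V] :
    -- exponential translations
    (SizeTradeoff.HasTranslation SizeTradeoff.Exponential
        (SizeTradeoff.CFGs V) (SizeTradeoff.NFAs V) ∧
      SizeTradeoff.HasTranslation SizeTradeoff.Exponential
        (SizeTradeoff.UCFGs V) (SizeTradeoff.UFAs V) ∧
      SizeTradeoff.HasTranslation SizeTradeoff.Exponential
        (SizeTradeoff.NFAs V) (SizeTradeoff.UCFGs V) ∧
      SizeTradeoff.HasTranslation SizeTradeoff.Exponential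
        (SizeTradeoff.NFAs V) (SizeTradeoff.UFAs V) ∧
      SizeTradeoff.HasTranslation SizeTradeoff.Exponential
        (SizeTradeoff.UFAs V) (SizeTradeoff.DFAs V) ∧
      SizeTradeoff.HasTranslation SizeTradeoff.Exponential
        (SizeTradeoff.DFAs V) (SizeTradeoff.WordSets V) ∧
      SizeTradeoff.HasTranslation SizeTradeoff.Exponential
        (SizeTradeoff.NFAs V) (SizeTradeoff.WordSets V)) ∧
    -- double-exponential translations
    (SizeTradeoff.HasTranslation SizeTradeoff.DoubleExponential
        (SizeTradeoff.CFGs V) (SizeTradeoff.UFAs V) ∧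
      SizeTradeoff.HasTranslation SizeTradeoff.DoubleExponential
        (SizeTradeoff.CFGs V) (SizeTradeoff.UCFGs V) ∧
      SizeTradeoff.HasTranslation SizeTradeoff.DoubleExponential
        (SizeTradeoff.UCFGs V) (SizeTradeoff.DFAs V) ∧
      SizeTradeoff.HasTranslation SizeTradeoff.DoubleExponential
        (SizeTradeoff.CFGs V) (SizeTradeoff.WordSets V)) ∧
    -- tightness of the exponential translations
    (SizeTradeoff.HasTightTranslation SizeTradeoff.Exponential
        (SizeTradeoff.CFGs V) (SizeTradeoff.NFAs V) ∧
      SizeTradeoff.HasTightTranslation SizeTradeoff.Exponential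
        (SizeTradeoff.UCFGs V) (SizeTradeoff.UFAs V) ∧
      SizeTradeoff.HasTightTranslation SizeTradeoff.RootExponential
        (SizeTradeoff.NFAs V) (SizeTradeoff.UFAs V) ∧
      SizeTradeoff.HasTightTranslation SizeTradeoff.RootExponential
        (SizeTradeoff.UFAs V) (SizeTradeoff.DFAs V) ∧
      SizeTradeoff.HasTightTranslation SizeTradeoff.Exponential
        (SizeTradeoff.DFAs V) (SizeTradeoff.WordSets V) ∧
      SizeTradeoff.HasTightTranslation SizeTradeoff.Exponential
        (SizeTradeoff.NFAs V) (SizeTradeoff.WordSets V)) ∧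
    -- tightness of the double-exponential translations
    (SizeTradeoff.HasTightTranslation SizeTradeoff.DoubleExponential
        (SizeTradeoff.CFGs V) (SizeTradeoff.UFAs V) ∧
      SizeTradeoff.HasTightTranslation SizeTradeoff.DoubleExponential
        (SizeTradeoff.UCFGs V) (SizeTradeoff.DFAs V) ∧
      SizeTradeoff.HasTightTranslation SizeTradeoff.DoubleExponential
        (SizeTradeoff.CFGs V) (SizeTradeoff.WordSets V)) := by
  open SizeTradeoff in
  let s := Infinite.natEmbedding V
  have hzo : s 0 ≠ s 1 := s.injective.ne (by decide)
  have hdz : s 2 ≠ s 0 := s.injective.ne (by decide)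
  have hdo : s 2 ≠ s 1 := s.injective.ne (by decide)
  have hE1 := tight_CFGs_NFAs (s 0) (s 1)
  have hE2 := tight_UCFGs_UFAs hdz hdo hzo
  have hE6 := tight_DFAs_WordSets hzo
  have hE7 := tight_NFAs_WordSets hzo
  have hDE1 := tight_CFGs_UFAs hzo
  have hDE3 := tight_UCFGs_DFAs hdz hdo hzo
  have hDE4 := tight_CFGs_WordSets hzo
  exact ⟨⟨hE1.hasTranslation, hE2.hasTranslation,
      (expBounded_NFAs_WordSets.trans_linear linearBounded_WordSets_UCFGs).hasTranslation,
      (expBounded_NFAs_WordSets.trans_linear linearBounded_WordSets_UFAs).hasTranslation,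
      (expBounded_UFAs_WordSets.trans_linear linearBounded_WordSets_DFAs).hasTranslation,
      hE6.hasTranslation, hE7.hasTranslation⟩,
    ⟨hDE1.hasTranslation,
      (doubleExpBounded_CFGs_WordSets.trans_linear linearBounded_WordSets_UCFGs).hasTranslation,
      hDE3.hasTranslation, hDE4.hasTranslation⟩,
    ⟨hE1, hE2, tight_NFAs_UFAs hzo, tight_UFAs_DFAs hdz hdo hzo, hE6, hE7⟩,
    ⟨hDE1, hDE3, hDE4⟩⟩
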